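/- All systems are real, linear and time-invariant with scalar input and output, given by finite-dimensional state-space realizations and started from zero initial state; signals live on $t\ge 0$ or $k=0,1,2,\ldots$. Let $h>0$, $M\ge 1$, $m\ge 0$ an integer, and $L=mh$. Let $F(s)$ be stable and strictly proper, $P(s)$ stable and proper (continuous time), and let $W_n(z),W_z(z),C(z),K_T(z),K_R(z)$ be stable and proper (discrete time). Let $(\mathcal S_\tau f)[k]=f(k\tau)$ be the ideal sampler, $(\mathcal H_\tau v)(t)=v[k]$ for $t\in[k\tau,(k+1)\tau)$ the zero-order hold, $\uparrow M$ and $\downarrow M$ the up- and downsampler, and $\mathbf L_N$ the discrete-time lifting, $(\mathbf L_N v)[k]=(v[kN],\ldots,v[kN+N-1])^T$. Put $$v_d=(\downarrow M)K_T\mathcal S_{h/M}Fw_c,\qquad z_d=W_zv_d,\qquad e_c=e^{-Ls}Fw_c-P\mathcal H_{h/M}K_R(\uparrow M)\nu_d .$$ Let $\mathcal T_R:(w_c,n_d)\mapsto e_c$ be the error system with $\nu_d=Cv_d+W_nn_d$, and $\mathcal T_T:w_c\mapsto(e_c,z_d)$ the error system with $\nu_d=Cv_d$; for $w_c\in L^2[0,\infty)$,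 $n_d\in l^2$ define $$\|\mathcal T_R\|^2=\sup_{(w_c,n_d)\ne 0}\frac{\|e_c\|_{L^2}^2}{\|w_c\|_{L^2}^2+\|n_d\|_{l^2}^2},\qquad \|\mathcal T_T\|^2=\sup_{w_c\neq0}\frac{\|e_c\|_{L^2}^2+\|z_d\|_{l^2}^2}{\|w_c\|_{L^2}^2}.$$ Then both norms are finite, and for $N=M,2M,3M,\ldots$ the following holds. 1. There are finite-dimensional linear time-invariant discrete-time systems $T_{R,N}:(\widetilde w,n_d)\mapsto\widetilde e$, with $\widetilde w,\widetilde e$ having values in $\mathbb R^N$, that realize the fast-sampling/fast-hold discretization of $\mathcal T_R$, i.e. $\widetilde e=\mathbf L_N\mathcal S_{h/N}e_c$ where $e_c$ is the output of $\mathcal T_R$ for the inputs $w_c=\mathcal H_{h/N}\mathbf L_N^{-1}\widetilde w$ and $n_d$. With $$\|T_{R,N}\|^2=\sup_{\substack{\widetilde w,n_d\in l^2\\(\widetilde w,n_d)\ne 0}}\frac{\|\widetilde e\|_{l^2}^2}{\|\widetilde w\|_{l^2}^2+\frac Nh\|n_d\|_{l^2}^2},$$ these norms are finite and $\lim_{N\to\infty}\|T_{R,N}\|=\|\mathcal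 T_R\|$. 2. There are finite-dimensional linear time-invariant discrete-time systems $T_{T,N}:\widetilde w\mapsto(\widetilde e,z_d)$ that realize the fast-sampling/fast-hold discretization of $\mathcal T_T$, i.e. $\widetilde e=\mathbf L_N\mathcal S_{h/N}e_c$ where $(e_c,z_d)$ is the output of $\mathcal T_T$ for the input $w_c=\mathcal H_{h/N}\mathbf L_N^{-1}\widetilde w$. With $$\|T_{T,N}\|^2=\sup_{\substack{\widetilde w\in l^2\\ \widetilde w\ne 0}}\frac{\|\widetilde e\|_{l^2}^2+\frac Nh\|z_d\|_{l^2}^2}{\|\widetilde w\|_{l^2}^2},$$ these norms are finite and $\lim_{N\to\infty}\|T_{T,N}\|=\|\mathcal T_T\|$. -/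

import Mathlib

open MeasureTheory Filter Topology
open scoped ENNReal Matrix

namespace CommSystem

noncomputable section

/-- A finite-dimensional linear time-invariant single-input single-output system with real
realization `{A, B, C, D}`, that is, with the proper rational transfer function
`C (λ I - A)⁻¹ B + D`, where `λ = s` in continuous time and `λ = z` in discrete time. -/
structure SISO where
  /-- dimension of the state space -/
  order : ℕ
  A : Matrix (Fin order) (Fin order) ℝ
  B : Fin order → ℝ
  C : Fin order → ℝ
  D : ℝ

/-- Continuous-time stability: all eigenvalues of `A` lie in the open left half plane. -/
def SISO.CTStable (G : SISO) : Prop :=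
  ∀ z ∈ spectrum ℂ (G.A.map (fun x : ℝ => (x : ℂ))), z.re < 0

/-- Discrete-time stability: all eigenvalues of `A` lie in the open unit disc. -/
def SISO.DTStable (G : SISO) : Prop :=
  ∀ z ∈ spectrum ℂ (G.A.map (fun x : ℝ => (x : ℂ))), ‖z‖ < 1

/-- Strict properness: no direct feedthrough. -/
def SISO.StrictlyProper (G : SISO) : Prop := G.D = 0

/-- Continuous-time response on `[0, ∞)` from the zero initial state,
`y(t) = ∫₀ᵗ C e^{A (t - τ)} B u(τ) dτ + D u(t)`. -/
def SISO.ctApply (G : SISO) (u : ℝ → ℝ) : ℝ → ℝ := fun t =>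
  (∫ τ in (0 : ℝ)..t, (G.C ⬝ᵥ (NormedSpace.exp ((t - τ) • G.A) *ᵥ G.B)) * u τ) + G.D * u t

/-- Discrete-time state trajectory `x[k+1] = A x[k] + B u[k]`, `x[0] = 0`. -/
def SISO.dtState (G : SISO) (u : ℕ → ℝ) : ℕ → Fin G.order → ℝ
  | 0 => 0
  | k + 1 => G.A *ᵥ G.dtState u k + u k • G.B

/-- Discrete-time response `y[k] = C x[k] + D u[k]` from the zero initial state. -/
def SISO.dtApply (G : SISO) (u : ℕ → ℝ) : ℕ → ℝ := fun k =>
  G.C ⬝ᵥ G.dtState u k + G.D * u k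

/-- A finite-dimensional discrete-time linear time-invariant system, given in state space, with
input components indexed by `ι` and output components indexed by `κ`. -/
structure DTSystem (ι κ : Type) where
  /-- dimension of the state space -/
  order : ℕ
  A : Matrix (Fin order) (Fin order) ℝ
  B : Matrix (Fin order) ι ℝ
  C : Matrix κ (Fin order) ℝ
  D : Matrix κ ι ℝ

/-- State trajectory `x[k+1] = A x[k] + B u[k]`, `x[0] = 0`. -/
def DTSystem.state {ι κ : Type} [Fintype ι] (T : DTSystem ι κ) (u : ℕ → ι → ℝ) :
    ℕ → Fin T.order → ℝ
  | 0 => 0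
  | k + 1 => T.A *ᵥ T.state u k + T.B *ᵥ u k

/-- Response `y[k] = C x[k] + D u[k]` from the zero initial state. -/
def DTSystem.apply {ι κ : Type} [Fintype ι] (T : DTSystem ι κ) (u : ℕ → ι → ℝ) :
    ℕ → κ → ℝ := fun k =>
  T.C *ᵥ T.state u k + T.D *ᵥ u k

/-- Ideal sampler with sampling period `p`. -/
def sampler (p : ℝ) (f : ℝ → ℝ) : ℕ → ℝ := fun k => f (k * p)

/-- Zero-order hold with sampling period `p`: the value on `[k p, (k+1) p)` is `v[k]`. -/
def hold (p : ℝ) (v : ℕ → ℝ) : ℝ → ℝ := fun t => if 0 ≤ t then v ⌊t / p⌋₊ else 0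

/-- Pure delay `e^{-L s}` of a signal on `[0, ∞)`. -/
def delay (L : ℝ) (f : ℝ → ℝ) : ℝ → ℝ := fun t => if L ≤ t then f (t - L) else 0

/-- Upsampler by the factor `M`. -/
def upsample (M : ℕ) (v : ℕ → ℝ) : ℕ → ℝ := fun k => if M ∣ k then v (k / M) else 0

/-- Downsampler by the factor `M`. -/
def downsample (M : ℕ) (v : ℕ → ℝ) : ℕ → ℝ := fun k => v (k * M)

/-- Discrete-time lifting by the factor `N`. -/
def dlift (N : ℕ) (v : ℕ → ℝ) : ℕ → Fin N → ℝ := fun k i => v (k * N + i)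

/-- Inverse discrete-time lifting by the factor `N`, for `0 < N`. -/
def idlift (N : ℕ) (v : ℕ → Fin N → ℝ) : ℕ → ℝ := fun j =>
  if hN : 0 < N then v (j / N) ⟨j % N, Nat.mod_lt j hN⟩ else 0

/-- Membership in `L²[0, ∞)`. -/
def IsL2 (f : ℝ → ℝ) : Prop := MemLp f 2 (volume.restrict (Set.Ici (0 : ℝ)))

/-- The squared `L²[0, ∞)` norm. -/
def ctEnergy (f : ℝ → ℝ) : ℝ≥0∞ := ∫⁻ t in Set.Ici (0 : ℝ), ‖f t‖ₑ ^ 2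

/-- The squared `l²` norm of a scalar sequence; the sequence is in `l²` iff it is finite. -/
def dtEnergy (v : ℕ → ℝ) : ℝ≥0∞ := ∑' k, ‖v k‖ₑ ^ 2

/-- The squared `l²` norm of a vector sequence; the sequence is in `l²` iff it is finite. -/
def vecEnergy {ι : Type} [Fintype ι] (v : ℕ → ι → ℝ) : ℝ≥0∞ := ∑' k, ∑ i, ‖v k i‖ₑ ^ 2

/-- The data of the communication system: hold/sampling parameters, analog filters `F`, `P`,
digital weights `Wn`, `Wz`, channel `Ch`, transmitting and receiving filters `KT`, `KR`. -/
structure Data where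
  /-- sampling period -/
  h : ℝ
  /-- down/upsampling factor -/
  M : ℕ
  /-- reconstruction delay -/
  L : ℝ
  F : SISO
  P : SISO
  Wn : SISO
  Wz : SISO
  Ch : SISO
  KT : SISO
  KR : SISO

/-- Standing assumptions on the data. -/
structure Data.Admissible (S : Data) : Prop where
  h_pos : 0 < S.h
  M_pos : 0 < S.M
  F_stable : S.F.CTStable
  F_strictlyProper : S.F.StrictlyProper
  P_stable : S.P.CTStable
  Wn_stable : S.Wn.DTStable
  Wz_stable : S.Wz.DTStable
  Ch_stable : S.Ch.DTStable
  KT_stable : S.KT.DTStable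
  KR_stable : S.KR.DTStable

/-- The transmitted signal `v_d = (↓M) K_T S_{h/M} F w_c`. -/
def Data.transmitted (S : Data) (w : ℝ → ℝ) : ℕ → ℝ :=
  downsample S.M (S.KT.dtApply (sampler (S.h / S.M) (S.F.ctApply w)))

/-- The analog signal `z_c = P H_{h/M} K_R (↑M) ν_d` reconstructed from the received `ν_d`. -/
def Data.reconstructed (S : Data) (nu : ℕ → ℝ) : ℝ → ℝ :=
  S.P.ctApply (hold (S.h / S.M) (S.KR.dtApply (upsample S.M nu)))

/-- The error system for receiver design, `(w_c, n_d) ↦ e_c`, with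
`e_c = e^{-L s} F w_c - z_c` and `ν_d = C v_d + W_n n_d`. -/
def Data.errR (S : Data) (w : ℝ → ℝ) (n : ℕ → ℝ) : ℝ → ℝ := fun t =>
  delay S.L (S.F.ctApply w) t -
    S.reconstructed (fun k => S.Ch.dtApply (S.transmitted w) k + S.Wn.dtApply n k) t

/-- First output `e_c` of the error system for transmitter design, `w_c ↦ (e_c, z_d)`, with
`e_c = e^{-L s} F w_c - z_c` and `ν_d = C v_d`. -/
def Data.errT (S : Data) (w : ℝ → ℝ) : ℝ → ℝ := fun t =>
  delay S.L (S.F.ctApply w) t - S.reconstructed (S.Ch.dtApply (S.transmitted w)) t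

/-- Second output `z_d = W_z v_d` of the error system for transmitter design. -/
def Data.weightedT (S : Data) (w : ℝ → ℝ) : ℕ → ℝ := S.Wz.dtApply (S.transmitted w)

/-- The induced norm of the error system for receiver design. -/
def Data.normR (S : Data) : ℝ≥0∞ :=
  (⨆ (w : ℝ → ℝ) (n : ℕ → ℝ) (_ : IsL2 w) (_ : dtEnergy n < ∞)
    (_ : ctEnergy w + dtEnergy n ≠ 0),
    ctEnergy (S.errR w n) / (ctEnergy w + dtEnergy n)) ^ (1 / 2 : ℝ)

/-- The induced norm of the error system for transmitter design. -/
def Data.normT (S : Data) : ℝ≥0∞ :=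
  (⨆ (w : ℝ → ℝ) (_ : IsL2 w) (_ : ctEnergy w ≠ 0),
    (ctEnergy (S.errT w) + dtEnergy (S.weightedT w)) / ctEnergy w) ^ (1 / 2 : ℝ)

/-- A discrete-time system with inputs `(w̃, n)` and output `ẽ`, scaled induced norm: its square is
`sup ‖ẽ‖² / (‖w̃‖² + c ‖n‖²)`. -/
def inputScaledNorm (c : ℝ) {N : ℕ} (T : DTSystem (Fin N ⊕ Unit) (Fin N)) : ℝ≥0∞ :=
  (⨆ (w : ℕ → Fin N → ℝ) (n : ℕ → ℝ) (_ : vecEnergy w < ∞) (_ : dtEnergy n < ∞)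
    (_ : vecEnergy w + dtEnergy n ≠ 0),
    vecEnergy (T.apply fun k => Sum.elim (w k) fun _ => n k) /
      (vecEnergy w + ENNReal.ofReal c * dtEnergy n)) ^ (1 / 2 : ℝ)

/-- A discrete-time system with input `w̃` and outputs `(ẽ, z)`, scaled induced norm: its square is
`sup (‖ẽ‖² + c ‖z‖²) / ‖w̃‖²`. -/
def outputScaledNorm (c : ℝ) {N : ℕ} (T : DTSystem (Fin N) (Fin N ⊕ Unit)) : ℝ≥0∞ :=
  (⨆ (w : ℕ → Fin N → ℝ) (_ : vecEnergy w < ∞) (_ : vecEnergy w ≠ 0),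
    (vecEnergy (fun k i => T.apply w k (Sum.inl i)) +
      ENNReal.ofReal c * dtEnergy (fun k => T.apply w k (Sum.inr ()))) /
      vecEnergy w) ^ (1 / 2 : ℝ)

/-- `T` is the fast-sampling/fast-hold discretization, with period `h / N` and lifted by `N`, of the
error system for receiver design. -/
def Data.IsFSFHR (S : Data) (N : ℕ) (T : DTSystem (Fin N ⊕ Unit) (Fin N)) : Prop :=
  ∀ (w : ℕ → Fin N → ℝ) (n : ℕ → ℝ),
    (T.apply fun k => Sum.elim (w k) fun _ => n k) =
      dlift N (sampler (S.h / N) (S.errR (hold (S.h / N) (idlift N w)) n))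

/-- `T` is the fast-sampling/fast-hold discretization, with period `h / N` and lifted by `N`, of the
error system for transmitter design; the discrete-time output `z_d` is kept as it is. -/
def Data.IsFSFHT (S : Data) (N : ℕ) (T : DTSystem (Fin N) (Fin N ⊕ Unit)) : Prop :=
  ∀ w : ℕ → Fin N → ℝ,
    T.apply w = fun k => Sum.elim
      (dlift N (sampler (S.h / N) (S.errT (hold (S.h / N) (idlift N w)))) k)
      (fun _ => S.weightedT (hold (S.h / N) (idlift N w)) k)

end

end CommSystem

namespace CommSystem

noncomputable section

/-! ### Exponential decay from spectral stability -/

section Stability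

open scoped Matrix.Norms.Operator

/-! Put `p = h / N`. A zero-order hold multiplies the squared norm by `p` (`ctEnergy_hold`), so
multiplying numerator and denominator of the discrete quotient by `p` makes it a quotient of
energies of the original signals. The weights `N / h` become `1`, the lifted output becomes the hold
of the samples of `e_c`, and the inputs `w_c` become exactly the finite-energy signals held on the
fast grid. Writing `H S` for sampling followed by holding with period `p`, the discrete norm is
therefore the gain of `H S` applied to the error system, over held inputs. It has to be compared
with the gain of the error system itself over all of `L²`.

Two estimates do this. On the output side, `H S - 1` after the error system has norm `O(p)`
(`Data.exists_hold_sampler_errR_le`). The kernel of a stable system decays exponentially and is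
Lipschitz with an exponentially decaying constant, so Young's inequality controls the sampling error
of the strictly proper responses (`SISO.CTStable.exists_hold_sampler_conv_le`). The feedthrough of
`P` acts on a signal held with period `h / M`, a multiple of `p`, and `H S` fixes such a signal. The
delay is a multiple of `p`, hence commutes with `H S`. On the input side, held signals approximate
every `L²` signal (`IsL2.eventually_exists_hold`) and the error system is bounded, so a nearly
optimal input may be replaced by a held one. `tendsto_gain` combines the two.

The two design problems are one: the transmitter system is the receiver system with noise restricted
to `{0}` and with `z_d` added to the output. The set `D` of admissible noises and the weight `κ` of
`z_d` are `(univ, 0)` for the receiver and `({0}, 1)` for the transmitter.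

The discretizations exist because the whole interconnection repeats with the frame `h`, that is,
with `N` fast samples. After lifting, each component is a linear recursion on a finite-dimensional
space, and such recursions are closed under cascade, stacking and linear combination
(`LiftRealizable.errR`). -/

theorem exists_norm_pow_le_of_spectrum {n : ℕ} (B : Matrix (Fin n) (Fin n) ℂ)
    (hB : ∀ z ∈ spectrum ℂ B, ‖z‖ < 1) :
    ∃ K ρ : ℝ, 0 < K ∧ 0 < ρ ∧ ρ < 1 ∧ ∀ k : ℕ, ‖B ^ k‖ ≤ K * ρ ^ k := by
  have hr : spectralRadius ℂ B < 1 := by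
    rcases isEmpty_or_nonempty (Fin n) with h | h
    · have : B = 0 := Subsingleton.elim _ _
      rw [this, spectrum.spectralRadius_zero]
      exact one_pos
    · have := spectrum.spectralRadius_lt_of_forall_lt B (r := 1)
        (fun z hz => by exact_mod_cast hB z hz)
      exact_mod_cast this
  obtain ⟨ρ, h1, h2⟩ := ENNReal.lt_iff_exists_nnreal_btwn.1 hr
  have hρ1 : ρ < 1 := by exact_mod_cast h2
  have hρ0 : 0 < ρ := by
    have := (zero_le).trans_lt h1
    exact_mod_cast this
  have hev := (spectrum.pow_nnnorm_pow_one_div_tendsto_nhds_spectralRadius B).eventually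
    (gt_mem_nhds h1)
  obtain ⟨k0, hk0⟩ := eventually_atTop.1 hev
  have hρ0' : (0 : ℝ) < ρ := by exact_mod_cast hρ0
  have hnn : ∀ k, 0 ≤ ‖B ^ k‖ / (ρ : ℝ) ^ k := fun k => by positivity
  -- Beyond `k0` the quotient is at most `1`, and the sum absorbs the finitely many others. The
  -- index `k0` is put in the sum so that the tail has `k > 0`, where the `k`-th root of Gelfand's
  -- formula can be undone.
  refine ⟨1 + ∑ k ∈ Finset.range (k0 + 1), ‖B ^ k‖ / (ρ : ℝ) ^ k, ρ, ?_, hρ0',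
    by exact_mod_cast hρ1, fun k => ?_⟩
  · have := Finset.sum_nonneg (s := Finset.range (k0 + 1)) (fun k _ => hnn k)
    linarith
  · rw [← div_le_iff₀ (by positivity)]
    rcases lt_or_ge k (k0 + 1) with hk | hk
    · have := Finset.single_le_sum (s := Finset.range (k0 + 1)) (fun k _ => hnn k)
        (Finset.mem_range.2 hk)
      linarith
    · have h3 := hk0 k (by omega)
      have hk' : (0 : ℝ) < k := by exact_mod_cast (by omega : 0 < k)
      have h4 : (‖B ^ k‖₊ : ℝ≥0∞) < (ρ : ℝ≥0∞) ^ (k : ℝ) := by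
        have := ENNReal.rpow_lt_rpow h3 hk'
        rwa [← ENNReal.rpow_mul, one_div_mul_cancel hk'.ne', ENNReal.rpow_one] at this
      have h5 : ‖B ^ k‖ < (ρ : ℝ) ^ k := by
        rw [ENNReal.rpow_natCast] at h4
        exact_mod_cast h4
      have h6 : ‖B ^ k‖ / (ρ : ℝ) ^ k ≤ 1 := (div_le_one (by positivity)).2 h5.le
      have := Finset.sum_nonneg (s := Finset.range (k0 + 1)) (fun k _ => hnn k)
      linarith

theorem norm_map_ofReal {n : ℕ} (A : Matrix (Fin n) (Fin n) ℝ) :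
    ‖A.map (fun x : ℝ => (x : ℂ))‖ = ‖A‖ := by
  simp [Matrix.linfty_opNorm_def]

theorem map_ofReal_pow {n : ℕ} (A : Matrix (Fin n) (Fin n) ℝ) (k : ℕ) :
    (A ^ k).map (fun x : ℝ => (x : ℂ)) = (A.map (fun x : ℝ => (x : ℂ))) ^ k :=
  map_pow (Complex.ofRealHom.mapMatrix) A k

theorem exists_norm_pow_le {n : ℕ} (A : Matrix (Fin n) (Fin n) ℝ)
    (hA : ∀ z ∈ spectrum ℂ (A.map (fun x : ℝ => (x : ℂ))), ‖z‖ < 1) :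
    ∃ K ρ : ℝ, 0 < K ∧ 0 < ρ ∧ ρ < 1 ∧ ∀ k : ℕ, ‖A ^ k‖ ≤ K * ρ ^ k := by
  obtain ⟨K, ρ, h1, h2, h3, h4⟩ := exists_norm_pow_le_of_spectrum _ hA
  refine ⟨K, ρ, h1, h2, h3, fun k => ?_⟩
  rw [← norm_map_ofReal, map_ofReal_pow]
  exact h4 k

theorem map_ofReal_exp {n : ℕ} (A : Matrix (Fin n) (Fin n) ℝ) :
    (NormedSpace.exp A).map (fun x : ℝ => (x : ℂ)) =
      NormedSpace.exp (A.map (fun x : ℝ => (x : ℂ))) := by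
  refine NormedSpace.map_exp (Complex.ofRealHom.mapMatrix) ?_ A
  exact continuous_id.matrix_map Complex.continuous_ofReal

theorem exp_mulVec_of_eigenvector {n : ℕ} (A : Matrix (Fin n) (Fin n) ℂ) (v : Fin n → ℂ) (μ : ℂ)
    (h : A *ᵥ v = μ • v) : NormedSpace.exp A *ᵥ v = Complex.exp μ • v := by
  have hpow : ∀ k : ℕ, A ^ k *ᵥ v = μ ^ k • v := by
    intro k
    induction k with
    | zero => simp
    | succ k ih => rw [pow_succ', ← Matrix.mulVec_mulVec, ih, Matrix.mulVec_smul, h, smul_smul,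
        pow_succ]
  let ev : Matrix (Fin n) (Fin n) ℂ →L[ℂ] (Fin n → ℂ) :=
    LinearMap.toContinuousLinearMap
      ((Matrix.mulVecBilin ℂ ℂ).flip v)
  have hev : ∀ X, ev X = X *ᵥ v := fun X => rfl
  have h1 := (NormedSpace.exp_series_hasSum_exp' (𝕂 := ℂ) A).mapL ev
  have h2 := (NormedSpace.exp_series_hasSum_exp' (𝕂 := ℂ) μ).smul_const v
  rw [← hev, Complex.exp_eq_exp_ℂ]
  refine h1.unique ?_
  convert h2 using 2 with k
  rw [hev, Matrix.smul_mulVec, hpow, smul_assoc]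

/-- `A` commutes with its exponential, so it preserves the `z`-eigenspace of the exponential and has
an eigenvector there, with eigenvalue `μ`. On that vector the exponential acts as `exp μ`, hence `z
= exp μ` and `‖z‖ = exp (re μ) < 1`. -/
theorem norm_lt_one_of_mem_spectrum_exp {n : ℕ} (A : Matrix (Fin n) (Fin n) ℂ)
    (hA : ∀ z ∈ spectrum ℂ A, z.re < 0) :
    ∀ z ∈ spectrum ℂ (NormedSpace.exp A), ‖z‖ < 1 := by
  intro z hz
  rw [← Matrix.spectrum_toLin', ← Module.End.hasEigenvalue_iff_mem_spectrum] at hz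
  let E := Module.End.eigenspace (Matrix.toLin' (NormedSpace.exp A)) z
  have hcomm : Commute A (NormedSpace.exp A) := (Commute.refl A).exp_right
  have hinv : ∀ x ∈ E, Matrix.toLin' A x ∈ E := by
    intro x hx
    rw [Module.End.mem_eigenspace_iff] at hx ⊢
    rw [Matrix.toLin'_apply, Matrix.toLin'_apply] at *
    rw [Matrix.mulVec_mulVec, ← hcomm.eq, ← Matrix.mulVec_mulVec, hx, Matrix.mulVec_smul]
  have hE : Nontrivial E := Submodule.nontrivial_iff_ne_bot.2 hz
  obtain ⟨μ, hμ⟩ := Module.End.exists_eigenvalue ((Matrix.toLin' A).restrict hinv)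
  obtain ⟨⟨v, hvE⟩, hv⟩ := hμ.exists_hasEigenvector
  have hv0 : v ≠ 0 := fun h => hv.2 (Subtype.ext h)
  have hAv : A *ᵥ v = μ • v := by
    have := congrArg Subtype.val hv.apply_eq_smul
    simpa using this
  have hμ' : μ ∈ spectrum ℂ A := by
    rw [← Matrix.spectrum_toLin', ← Module.End.hasEigenvalue_iff_mem_spectrum]
    refine Module.End.hasEigenvalue_of_hasEigenvector (x := v) ⟨?_, hv0⟩
    rw [Module.End.mem_eigenspace_iff, Matrix.toLin'_apply, hAv]
  have hzv : NormedSpace.exp A *ᵥ v = z • v := by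
    have := Module.End.mem_eigenspace_iff.1 hvE
    rwa [Matrix.toLin'_apply] at this
  rw [exp_mulVec_of_eigenvector A v μ hAv] at hzv
  have hz' : Complex.exp μ = z := smul_left_injective ℂ hv0 hzv
  rw [← hz', Complex.norm_exp, Real.exp_lt_one_iff]
  exact hA μ hμ'

/-- Split `t` into its integer and fractional parts. Powers of `exp A` decay geometrically by the
discrete result, and the fractional part stays in a compact interval. -/
theorem exists_norm_exp_le {n : ℕ} (A : Matrix (Fin n) (Fin n) ℝ)
    (hA : ∀ z ∈ spectrum ℂ (A.map (fun x : ℝ => (x : ℂ))), z.re < 0) :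
    ∃ K r : ℝ, 0 < K ∧ 0 < r ∧ ∀ t : ℝ, 0 ≤ t →
      ‖NormedSpace.exp (t • A)‖ ≤ K * Real.exp (-(r * t)) := by
  obtain ⟨K, ρ, h1, h2, h3, h4⟩ := exists_norm_pow_le (NormedSpace.exp A) (by
    rw [map_ofReal_exp]
    exact norm_lt_one_of_mem_spectrum_exp _ hA)
  have hcont : Continuous fun t : ℝ => NormedSpace.exp (t • A) :=
    (differentiable_exp_smul_const ℝ A).continuous
  obtain ⟨c, hc⟩ := (isCompact_Icc (a := (0 : ℝ)) (b := 1)).exists_bound_of_continuousOn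
    hcont.continuousOn
  have hc0 : 0 ≤ c := (norm_nonneg _).trans (hc 0 (by simp))
  have hlog : 0 < -Real.log ρ := by linarith [Real.log_neg h2 h3]
  refine ⟨(K * (c + 1)) * ρ⁻¹, -Real.log ρ, by positivity, hlog, fun t ht => ?_⟩
  set k := ⌊t⌋₊ with hk
  have hk1 : (k : ℝ) ≤ t := Nat.floor_le ht
  have hk2 : t < k + 1 := Nat.lt_floor_add_one t
  have hsplit : t • A = k • A + (t - k) • A := by
    rw [← Nat.cast_smul_eq_nsmul ℝ, ← add_smul]
    congr 1
    ring
  have hcm : Commute (k • A) ((t - k) • A) :=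
    ((Commute.refl A).smul_right _).smul_left _
  rw [hsplit, Matrix.exp_add_of_commute _ _ hcm, Matrix.exp_nsmul]
  -- Rounding `t` down to `k` loses less than one unit of time, hence at most one factor `ρ⁻¹`.
  have h5 : ρ ^ k ≤ ρ⁻¹ * Real.exp (-(-Real.log ρ * t)) := by
    have : Real.exp (-(-Real.log ρ * t)) = ρ ^ t := by
      rw [Real.rpow_def_of_pos h2]; congr 1; ring
    rw [this, ← Real.rpow_natCast, ← Real.rpow_neg_one, ← Real.rpow_add h2]
    exact Real.rpow_le_rpow_of_exponent_ge h2 h3.le (by linarith)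
  calc ‖NormedSpace.exp A ^ k * NormedSpace.exp ((t - k) • A)‖
      ≤ ‖NormedSpace.exp A ^ k‖ * ‖NormedSpace.exp ((t - k) • A)‖ := norm_mul_le _ _
    _ ≤ (K * ρ ^ k) * (c + 1) := by
        gcongr
        · exact h4 k
        · exact (hc _ ⟨by linarith, by linarith⟩).trans (by linarith)
    _ ≤ (K * (ρ⁻¹ * Real.exp (-(-Real.log ρ * t)))) * (c + 1) := by gcongr
    _ = _ := by ring

/-- The linear functional `X ↦ C X B` on square matrices. -/
def SISO.functional (G : SISO) : Matrix (Fin G.order) (Fin G.order) ℝ →L[ℝ] ℝ :=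
  LinearMap.toContinuousLinearMap
    { toFun := fun X => G.C ⬝ᵥ (X *ᵥ G.B)
      map_add' := fun X Y => by rw [Matrix.add_mulVec, dotProduct_add]
      map_smul' := fun c X => by rw [Matrix.smul_mulVec, dotProduct_smul]; rfl }

theorem SISO.functional_apply (G : SISO) (X : Matrix (Fin G.order) (Fin G.order) ℝ) :
    G.functional X = G.C ⬝ᵥ (X *ᵥ G.B) := rfl

theorem SISO.exists_functional_bound (G : SISO) :
    ∃ c : ℝ, 0 < c ∧ ∀ X : Matrix (Fin G.order) (Fin G.order) ℝ, |G.functional X| ≤ c * ‖X‖ := by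
  refine ⟨(∑ i, |G.C i|) * ‖G.B‖ + 1, by positivity, fun X => ?_⟩
  calc |G.functional X| ≤ ∑ i, |G.C i * (X *ᵥ G.B) i| := by
        rw [G.functional_apply, dotProduct]
        exact Finset.abs_sum_le_sum_abs _ _
    _ ≤ ∑ i, |G.C i| * (‖X‖ * ‖G.B‖) := by
        refine Finset.sum_le_sum fun i _ => ?_
        rw [abs_mul]
        gcongr
        exact (norm_le_pi_norm (X *ᵥ G.B) i).trans (Matrix.linfty_opNorm_mulVec X G.B)
    _ = ((∑ i, |G.C i|) * ‖G.B‖) * ‖X‖ := by rw [← Finset.sum_mul]; ring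
    _ ≤ _ := by gcongr; linarith

/-- The continuous-time impulse response without the feedthrough term. -/
def SISO.ctKernel (G : SISO) (t : ℝ) : ℝ := G.C ⬝ᵥ (NormedSpace.exp (t • G.A) *ᵥ G.B)

theorem SISO.continuous_ctKernel (G : SISO) : Continuous G.ctKernel :=
  G.functional.continuous.comp (differentiable_exp_smul_const ℝ G.A).continuous

theorem SISO.exists_pow_bound (G : SISO) (hG : G.DTStable) :
    ∃ K ρ : ℝ, 0 < K ∧ 0 < ρ ∧ ρ < 1 ∧ ∀ k : ℕ, |G.C ⬝ᵥ (G.A ^ k *ᵥ G.B)| ≤ K * ρ ^ k := by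
  obtain ⟨K, ρ, h1, h2, h3, h4⟩ := exists_norm_pow_le G.A hG
  obtain ⟨c, hc, hl⟩ := G.exists_functional_bound
  refine ⟨c * K, ρ, by positivity, h2, h3, fun k => ?_⟩
  rw [← G.functional_apply]
  calc |G.functional (G.A ^ k)| ≤ c * ‖G.A ^ k‖ := hl _
    _ ≤ c * (K * ρ ^ k) := by
        gcongr
        exact h4 k
    _ = _ := by ring

/-- The increment bound is the mean value inequality: the derivative of the kernel is the same
functional of `exp (s • A) * A`, which decays at the same rate. The factor `‖A‖ + 1` lets one
constant serve both bounds. -/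
theorem SISO.exists_ctKernel_bound (G : SISO) (hG : G.CTStable) :
    ∃ K r : ℝ, 0 < K ∧ 0 < r ∧ (∀ t : ℝ, 0 ≤ t → |G.ctKernel t| ≤ K * Real.exp (-(r * t))) ∧
      ∀ t d : ℝ, 0 ≤ t → 0 ≤ d →
        |G.ctKernel (t + d) - G.ctKernel t| ≤ K * d * Real.exp (-(r * t)) := by
  obtain ⟨K, r, hK, hr, hb⟩ := exists_norm_exp_le G.A hG
  obtain ⟨c, hc, hl⟩ := G.exists_functional_bound
  set K' := c * K * (‖G.A‖ + 1) with hK'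
  refine ⟨K', r, by positivity, hr, fun t ht => ?_, fun t d ht hd => ?_⟩
  · calc |G.functional (NormedSpace.exp (t • G.A))| ≤ c * ‖NormedSpace.exp (t • G.A)‖ := hl _
      _ ≤ c * (K * Real.exp (-(r * t))) * 1 := by
          rw [mul_one]
          gcongr
          exact hb t ht
      _ ≤ c * (K * Real.exp (-(r * t))) * (‖G.A‖ + 1) := by
          gcongr
          linarith [norm_nonneg G.A]
      _ = _ := by rw [hK']; ring
  · have hder : ∀ s : ℝ,
        HasDerivAt G.ctKernel (G.functional (NormedSpace.exp (s • G.A) * G.A)) s := fun s =>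
      G.functional.hasFDerivAt.comp_hasDerivAt s (hasDerivAt_exp_smul_const G.A s)
    have hmv := Convex.norm_image_sub_le_of_norm_hasDerivWithin_le (f := G.ctKernel)
      (f' := fun s => G.functional (NormedSpace.exp (s • G.A) * G.A))
      (C := K' * Real.exp (-(r * t)))
      (s := Set.Icc t (t + d)) (x := t) (y := t + d)
      (fun s _ => (hder s).hasDerivWithinAt) (fun s hs => ?_) (convex_Icc _ _)
      ⟨le_rfl, by linarith⟩ ⟨by linarith, le_rfl⟩
    · rw [Real.norm_eq_abs, Real.norm_eq_abs, add_sub_cancel_left, abs_of_nonneg hd] at hmv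
      linarith
    · have hs0 : 0 ≤ s := ht.trans hs.1
      calc |G.functional (NormedSpace.exp (s • G.A) * G.A)|
          ≤ c * ‖NormedSpace.exp (s • G.A) * G.A‖ := hl _
        _ ≤ c * (‖NormedSpace.exp (s • G.A)‖ * ‖G.A‖) := by gcongr; exact norm_mul_le _ _
        _ ≤ c * ((K * Real.exp (-(r * t))) * (‖G.A‖ + 1)) := by
            gcongr
            · refine (hb s hs0).trans ?_
              gcongr
              exact hs.1
            · linarith
        _ = _ := by rw [hK']; ring

end Stability

/-! ### Realizable maps between vector sequences -/

section Realization

variable {ι κ σ : Type} [Fintype ι]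

/-- A map between vector-valued sequences is realizable if it is the response of a
finite-dimensional discrete-time linear time-invariant system. -/
def Realizable (Φ : (ℕ → ι → ℝ) → ℕ → κ → ℝ) : Prop :=
  ∃ T : DTSystem ι κ, ∀ u, T.apply u = Φ u

/-- A map given by a linear recursion on a finite-dimensional state space is realizable. -/
theorem realizable_of_linear {V : Type} [AddCommGroup V] [Module ℝ V] [FiniteDimensional ℝ V]
    (a : V →ₗ[ℝ] V) (b : (ι → ℝ) →ₗ[ℝ] V) (c : V →ₗ[ℝ] (κ → ℝ)) (d : (ι → ℝ) →ₗ[ℝ] (κ → ℝ))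
    (Φ : (ℕ → ι → ℝ) → ℕ → κ → ℝ) (x : (ℕ → ι → ℝ) → ℕ → V) (hx0 : ∀ u, x u 0 = 0)
    (hx : ∀ u k, x u (k + 1) = a (x u k) + b (u k)) (hΦ : ∀ u k, Φ u k = c (x u k) + d (u k)) :
    Realizable Φ := by
  classical
  let e := (Module.finBasis ℝ V).equivFun
  refine ⟨⟨Module.finrank ℝ V, LinearMap.toMatrix' (e.toLinearMap ∘ₗ a ∘ₗ e.symm.toLinearMap),
    LinearMap.toMatrix' (e.toLinearMap ∘ₗ b), LinearMap.toMatrix' (c ∘ₗ e.symm.toLinearMap),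
    LinearMap.toMatrix' d⟩, fun u => ?_⟩
  set T : DTSystem ι κ := ⟨Module.finrank ℝ V,
    LinearMap.toMatrix' (e.toLinearMap ∘ₗ a ∘ₗ e.symm.toLinearMap),
    LinearMap.toMatrix' (e.toLinearMap ∘ₗ b), LinearMap.toMatrix' (c ∘ₗ e.symm.toLinearMap),
    LinearMap.toMatrix' d⟩
  have hstate : ∀ k, T.state u k = e (x u k) := by
    intro k
    induction k with
    | zero => rw [hx0, map_zero]; rfl
    | succ k ih =>
      rw [hx, map_add]
      change LinearMap.toMatrix' (e.toLinearMap ∘ₗ a ∘ₗ e.symm.toLinearMap) *ᵥ T.state u k +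
        LinearMap.toMatrix' (e.toLinearMap ∘ₗ b) *ᵥ u k = _
      rw [ih]
      simp [← Matrix.toLin'_apply]
  funext k
  change LinearMap.toMatrix' (c ∘ₗ e.symm.toLinearMap) *ᵥ T.state u k +
    LinearMap.toMatrix' d *ᵥ u k = _
  rw [hstate, hΦ]
  simp [← Matrix.toLin'_apply]

theorem Realizable.congr {Φ Ψ : (ℕ → ι → ℝ) → ℕ → κ → ℝ} (h : Realizable Φ)
    (e : ∀ u, Ψ u = Φ u) : Realizable Ψ := by
  obtain ⟨T, hT⟩ := h
  exact ⟨T, fun u => (hT u).trans (e u).symm⟩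

/-- Memoryless linear maps are realizable. -/
theorem realizable_static (d : (ι → ℝ) →ₗ[ℝ] (κ → ℝ)) :
    Realizable (fun (u : ℕ → ι → ℝ) k => d (u k)) :=
  realizable_of_linear (V := PUnit) 0 0 0 d _ (fun _ _ => 0) (fun _ => rfl) (by simp) (by simp)

theorem realizable_unitDelay :
    Realizable (fun (u : ℕ → ι → ℝ) k => if k = 0 then 0 else u (k - 1)) :=
  realizable_of_linear (V := ι → ℝ) 0 LinearMap.id LinearMap.id 0 _
    (fun u k => if k = 0 then 0 else u (k - 1)) (fun _ => rfl) (by simp) (by simp)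

theorem Realizable.comp [Fintype κ] {Φ : (ℕ → ι → ℝ) → ℕ → κ → ℝ} {Ψ : (ℕ → κ → ℝ) → ℕ → σ → ℝ}
    (hΨ : Realizable Ψ) (hΦ : Realizable Φ) : Realizable (fun u => Ψ (Φ u)) := by
  obtain ⟨T, hT⟩ := hΦ
  obtain ⟨R, hR⟩ := hΨ
  let fl := LinearMap.fst ℝ (Fin T.order → ℝ) (Fin R.order → ℝ)
  let sl := LinearMap.snd ℝ (Fin T.order → ℝ) (Fin R.order → ℝ)
  -- Cascade: the state is the pair of states, and the output equation of `T` is substituted for the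
  -- input of `R`.
  refine realizable_of_linear (V := (Fin T.order → ℝ) × (Fin R.order → ℝ))
    (LinearMap.prod (T.A.mulVecLin ∘ₗ fl)
      (R.A.mulVecLin ∘ₗ sl + R.B.mulVecLin ∘ₗ T.C.mulVecLin ∘ₗ fl))
    (LinearMap.prod T.B.mulVecLin (R.B.mulVecLin ∘ₗ T.D.mulVecLin))
    (R.C.mulVecLin ∘ₗ sl + R.D.mulVecLin ∘ₗ T.C.mulVecLin ∘ₗ fl)
    (R.D.mulVecLin ∘ₗ T.D.mulVecLin)
    _ (fun u k => (T.state u k, R.state (T.apply u) k)) (fun u => rfl) (fun u k => ?_)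
    (fun u k => ?_)
  · have h1 : T.state u (k + 1) = T.A *ᵥ T.state u k + T.B *ᵥ u k := rfl
    have h2 : R.state (T.apply u) (k + 1) =
      R.A *ᵥ R.state (T.apply u) k + R.B *ᵥ (T.C *ᵥ T.state u k + T.D *ᵥ u k) := rfl
    rw [h1, h2, Matrix.mulVec_add]
    ext1 <;> simp [fl, sl, add_assoc]
  · rw [← hT, ← hR]
    have h2 : R.apply (T.apply u) k =
      R.C *ᵥ R.state (T.apply u) k + R.D *ᵥ (T.C *ᵥ T.state u k + T.D *ᵥ u k) := rfl
    rw [h2, Matrix.mulVec_add]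
    simp [fl, sl, add_assoc]

theorem Realizable.sumElim {Φ : (ℕ → ι → ℝ) → ℕ → κ → ℝ} {Ψ : (ℕ → ι → ℝ) → ℕ → σ → ℝ}
    (hΦ : Realizable Φ) (hΨ : Realizable Ψ) :
    Realizable (fun u k => Sum.elim (Φ u k) (Ψ u k)) := by
  obtain ⟨T, hT⟩ := hΦ
  obtain ⟨R, hR⟩ := hΨ
  let fl := LinearMap.fst ℝ (Fin T.order → ℝ) (Fin R.order → ℝ)
  let sl := LinearMap.snd ℝ (Fin T.order → ℝ) (Fin R.order → ℝ)
  let el := (LinearEquiv.sumArrowLequivProdArrow κ σ ℝ ℝ).symm.toLinearMap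
  refine realizable_of_linear (V := (Fin T.order → ℝ) × (Fin R.order → ℝ))
    (LinearMap.prod (T.A.mulVecLin ∘ₗ fl) (R.A.mulVecLin ∘ₗ sl))
    (LinearMap.prod T.B.mulVecLin R.B.mulVecLin)
    (el ∘ₗ LinearMap.prod (T.C.mulVecLin ∘ₗ fl) (R.C.mulVecLin ∘ₗ sl))
    (el ∘ₗ LinearMap.prod T.D.mulVecLin R.D.mulVecLin)
    _ (fun u k => (T.state u k, R.state u k)) (fun u => rfl) (fun u k => rfl)
    (fun u k => ?_)
  rw [← hT, ← hR]
  funext i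
  rcases i with i | i <;> rfl

theorem Realizable.linear_comb [Fintype κ] {Φ Ψ : (ℕ → ι → ℝ) → ℕ → κ → ℝ}
    (hΦ : Realizable Φ) (hΨ : Realizable Ψ) (a b : ℝ) :
    Realizable (fun u k => a • Φ u k + b • Ψ u k) := by
  refine ((realizable_static
    ((a • LinearMap.fst ℝ (κ → ℝ) (κ → ℝ) + b • LinearMap.snd ℝ (κ → ℝ) (κ → ℝ)) ∘ₗ
      (LinearEquiv.sumArrowLequivProdArrow κ κ ℝ ℝ).toLinearMap)).comp
      (hΦ.sumElim hΨ)).congr (fun u => ?_)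
  rfl

end Realization

/-! ### Lifting, and multirate operations on lifted signals -/

section Lifting

/-- The state after `i` steps of a block with input block `u`. -/
def SISO.blockState (G : SISO) (N : ℕ) :
    ℕ → ((Fin G.order → ℝ) × (Fin N → ℝ)) →ₗ[ℝ] (Fin G.order → ℝ)
  | 0 => LinearMap.fst ℝ _ _
  | i + 1 => G.A.mulVecLin ∘ₗ G.blockState N i +
      -- The default beyond the end of the block is never used: only the indices `i ≤ N` of
      -- `blockState` occur below.
      if h : i < N then
        (LinearMap.toSpanSingleton ℝ _ G.B) ∘ₗ LinearMap.proj ⟨i, h⟩ ∘ₗ LinearMap.snd ℝ _ _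
      else 0

/-- The state inside a block is a linear function of the state at its start and of the inputs of the
block. The case `i = N` is the state recursion of the lifted system, and `i < N` gives its outputs.
-/
theorem SISO.blockState_eq (G : SISO) {N : ℕ} (v : ℕ → ℝ) (k i : ℕ) (hi : i ≤ N) :
    G.blockState N i (G.dtState v (k * N), dlift N v k) = G.dtState v (k * N + i) := by
  induction i with
  | zero => rfl
  | succ i ih =>
    have hi' : i < N := hi
    have h1 : G.dtState v (k * N + (i + 1)) =
      G.A *ᵥ G.dtState v (k * N + i) + v (k * N + i) • G.B := rfl
    rw [h1, ← ih hi'.le, SISO.blockState, dif_pos hi']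
    rfl

theorem dlift_idlift {N : ℕ} (w : ℕ → Fin N → ℝ) : dlift N (idlift N w) = w := by
  funext k i
  have hN : 0 < N := i.pos
  have h1 : (k * N + i) / N = k := by
    rw [add_comm, Nat.add_mul_div_right _ _ hN, Nat.div_eq_of_lt i.2, zero_add]
  have h2 : (k * N + i) % N = i := by
    rw [add_comm, Nat.add_mul_mod_self_right, Nat.mod_eq_of_lt i.2]
  simp only [dlift, idlift, dif_pos hN, h1, h2]

theorem idlift_dlift {N : ℕ} (hN : 0 < N) (v : ℕ → ℝ) : idlift N (dlift N v) = v := by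
  funext j
  simp only [dlift, idlift, dif_pos hN, mul_comm (j / N) N, Nat.div_add_mod]

/-- The lifting of a discrete-time system is realizable. -/
theorem SISO.realizable_lift (G : SISO) (N : ℕ) :
    Realizable (fun u : ℕ → Fin N → ℝ => dlift N (G.dtApply (idlift N u))) := by
  let out : ((Fin G.order → ℝ) × (Fin N → ℝ)) →ₗ[ℝ] (Fin N → ℝ) := LinearMap.pi fun i =>
    (dotProductBilin ℝ ℝ G.C) ∘ₗ G.blockState N i + G.D • LinearMap.proj i ∘ₗ LinearMap.snd ℝ _ _
  refine realizable_of_linear (V := Fin G.order → ℝ)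
    (G.blockState N N ∘ₗ LinearMap.inl ℝ _ _) (G.blockState N N ∘ₗ LinearMap.inr ℝ _ _)
    (out ∘ₗ LinearMap.inl ℝ _ _) (out ∘ₗ LinearMap.inr ℝ _ _) _
    (fun u k => G.dtState (idlift N u) (k * N)) (fun u => ?_) (fun u k => ?_) (fun u k => ?_)
  · simp only [zero_mul]; rfl
  · rw [LinearMap.comp_apply, LinearMap.comp_apply, ← map_add, LinearMap.inl_apply,
      LinearMap.inr_apply, Prod.mk_add_mk, add_zero, zero_add, add_mul, one_mul,
      ← G.blockState_eq _ _ _ le_rfl, dlift_idlift]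
  · rw [LinearMap.comp_apply, LinearMap.comp_apply, ← map_add, LinearMap.inl_apply,
      LinearMap.inr_apply, Prod.mk_add_mk, add_zero, zero_add]
    funext i
    have h := G.blockState_eq (idlift N u) k i i.2.le
    rw [dlift_idlift] at h
    have h' : idlift N u (k * N + i) = u k i := congrFun (congrFun (dlift_idlift u) k) i
    change G.C ⬝ᵥ G.dtState (idlift N u) (k * N + i) + G.D * idlift N u (k * N + i) =
      G.C ⬝ᵥ (G.blockState N i (_, u k)) + G.D * u k i
    rw [h, h']

variable {ι : Type} [Fintype ι]

/-- A scalar signal depending on the input is periodically realizable with period `N` if its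
lifting by `N` is realizable. -/
def LiftRealizable (N : ℕ) (s : (ℕ → ι → ℝ) → ℕ → ℝ) : Prop :=
  Realizable fun u => dlift N (s u)

/-- For `N > 0` lifting is invertible, so filtering a signal and then lifting is a cascade of the
lifted filter with the lifted signal. -/
theorem LiftRealizable.dtApply {N : ℕ} (hN : 0 < N) {s : (ℕ → ι → ℝ) → ℕ → ℝ}
    (hs : LiftRealizable N s) (G : SISO) : LiftRealizable N (fun u => G.dtApply (s u)) :=
  ((G.realizable_lift N).comp hs).congr fun u => by rw [idlift_dlift hN]

theorem LiftRealizable.congr {N : ℕ} {s r : (ℕ → ι → ℝ) → ℕ → ℝ}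
    (hs : LiftRealizable N s) (h : ∀ u, r u = s u) : LiftRealizable N r :=
  Realizable.congr hs fun u => by rw [h]

/-- Rearranging, linearly, the samples of a block gives a realizable signal. -/
theorem LiftRealizable.block {N K : ℕ} {s r : (ℕ → ι → ℝ) → ℕ → ℝ}
    (hs : LiftRealizable N s) (d : (Fin N → ℝ) →ₗ[ℝ] (Fin K → ℝ))
    (h : ∀ u k (i : Fin K), r u (k * K + i) = d (dlift N (s u) k) i) : LiftRealizable K r :=
  ((realizable_static d).comp hs).congr fun u => by
    funext k i
    exact h u k i

theorem LiftRealizable.linear_comb {N : ℕ} {s r : (ℕ → ι → ℝ) → ℕ → ℝ}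
    (hs : LiftRealizable N s) (hr : LiftRealizable N r) (a b : ℝ) :
    LiftRealizable N (fun u k => a * s u k + b * r u k) :=
  Realizable.linear_comb hs hr a b

/-- Sampling every `l`-th value. -/
theorem LiftRealizable.decimate {M l : ℕ} {s : (ℕ → ι → ℝ) → ℕ → ℝ} (hl : 0 < l)
    (hs : LiftRealizable (M * l) s) : LiftRealizable M (fun u k => s u (k * l)) := by
  refine hs.block (LinearMap.funLeft ℝ ℝ fun i : Fin M =>
    (⟨i * l, Nat.mul_lt_mul_of_pos_right i.2 hl⟩ : Fin (M * l))) fun u k i => ?_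
  simp only [LinearMap.funLeft_apply, dlift]
  congr 1
  ring

/-- Holding every value for `l` steps. -/
theorem LiftRealizable.repeat {M l : ℕ} {s : (ℕ → ι → ℝ) → ℕ → ℝ}
    (hs : LiftRealizable M s) : LiftRealizable (M * l) (fun u k => s u (k / l)) := by
  refine hs.block (LinearMap.funLeft ℝ ℝ fun i : Fin (M * l) =>
    (⟨i / l, Nat.div_lt_of_lt_mul (i.2.trans_eq (mul_comm M l))⟩ : Fin M)) fun u k i => ?_
  -- An index `i` of a block of length `M * l` exists, so `l` cannot vanish.
  have hl : 0 < l := Nat.pos_of_ne_zero fun h => by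
    have := i.2
    simp [h] at this
  simp only [LinearMap.funLeft_apply, dlift]
  rw [← mul_assoc, add_comm, Nat.add_mul_div_right _ _ hl, add_comm]

theorem LiftRealizable.downsample {M : ℕ} (hM : 0 < M) {s : (ℕ → ι → ℝ) → ℕ → ℝ}
    (hs : LiftRealizable M s) : LiftRealizable 1 (fun u => downsample M (s u)) := by
  have hs' : LiftRealizable (1 * M) s := by rwa [one_mul]
  exact hs'.decimate hM

theorem LiftRealizable.upsample {M : ℕ} {s : (ℕ → ι → ℝ) → ℕ → ℝ}
    (hs : LiftRealizable 1 s) : LiftRealizable M (fun u => upsample M (s u)) := by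
  -- Among `k * M + i` with `i < M`, only `i = 0` is divisible by `M`.
  refine hs.block (LinearMap.pi fun i : Fin M =>
    if (i : ℕ) = 0 then LinearMap.proj 0 else 0) fun u k i => ?_
  have hM : 0 < M := i.pos
  rw [LinearMap.pi_apply, CommSystem.upsample]
  by_cases hi : (i : ℕ) = 0
  · rw [if_pos hi, hi, add_zero, if_pos (Nat.dvd_mul_left M k), Nat.mul_div_cancel _ hM]
    simp [dlift]
  · rw [if_neg hi, if_neg]
    · rfl
    · rw [(Nat.dvd_mul_left M k |> Nat.dvd_add_right)]
      exact fun h => hi (Nat.eq_zero_of_dvd_of_lt h i.2)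

/-- Delaying by a whole number of blocks. -/
theorem LiftRealizable.delay {N : ℕ} {s : (ℕ → ι → ℝ) → ℕ → ℝ}
    (hs : LiftRealizable N s) (m : ℕ) :
    LiftRealizable N (fun u j => if m * N ≤ j then s u (j - m * N) else 0) := by
  induction m with
  | zero => simpa using hs
  | succ m ih =>
    refine (realizable_unitDelay.comp ih).congr fun u => ?_
    funext k i
    rcases k with _ | k
    · have hi := i.2
      simp only [dlift]
      rw [if_neg (by nlinarith), if_pos trivial]
      rfl
    · rw [if_neg (by omega)]
      simp only [dlift, Nat.add_sub_cancel, add_mul, one_mul]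
      have e1 : k * N + N + i - (m * N + N) = k * N + i - m * N := by omega
      rw [e1]
      congr 1
      simp only [eq_iff_iff]
      omega

end Lifting

/-! ### Step-invariant discretization -/

section Discretization

theorem SISO.dtState_eq_sum (G : SISO) (u : ℕ → ℝ) (k : ℕ) :
    G.dtState u k = ∑ j ∈ Finset.range k, u j • (G.A ^ (k - 1 - j) *ᵥ G.B) := by
  induction k with
  | zero => rfl
  | succ k ih =>
    rw [SISO.dtState, ih, Finset.sum_range_succ, Matrix.mulVec_sum]
    congr 1
    · refine Finset.sum_congr rfl fun j hj => ?_
      have hj' := Finset.mem_range.1 hj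
      rw [Matrix.mulVec_smul, Matrix.mulVec_mulVec, ← pow_succ',
        show k - 1 - j + 1 = k + 1 - 1 - j by omega]
    · simp

theorem SISO.dtApply_eq_sum (G : SISO) (u : ℕ → ℝ) (k : ℕ) :
    G.dtApply u k =
      ∑ j ∈ Finset.range k, (G.C ⬝ᵥ (G.A ^ (k - 1 - j) *ᵥ G.B)) * u j + G.D * u k := by
  rw [SISO.dtApply, SISO.dtState_eq_sum, dotProduct_sum]
  congr 1
  refine Finset.sum_congr rfl fun j _ => ?_
  rw [dotProduct_smul, smul_eq_mul, mul_comm]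

/-- The step-invariant discretization with sampling period `p`. -/
def SISO.discretize (G : SISO) (p : ℝ) : SISO where
  order := G.order
  A := NormedSpace.exp (p • G.A)
  B := fun i => ∫ s in (0 : ℝ)..p, (NormedSpace.exp (s • G.A) *ᵥ G.B) i
  C := G.C
  D := G.D

theorem hold_of_mem {p : ℝ} (hp : 0 < p) (u : ℕ → ℝ) (j : ℕ) {t : ℝ} (h1 : j * p ≤ t)
    (h2 : t < (j + 1) * p) : hold p u t = u j := by
  have ht : 0 ≤ t := le_trans (by positivity) h1
  rw [hold, if_pos ht]
  congr 1
  rw [Nat.floor_eq_iff (by positivity), le_div_iff₀ hp, div_lt_iff₀ hp]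
  exact ⟨h1, h2⟩

theorem hold_mul {p : ℝ} (hp : 0 < p) (u : ℕ → ℝ) (k : ℕ) : hold p u (k * p) = u k :=
  hold_of_mem hp u k le_rfl (by nlinarith)

/-- Interval integrals live on half-open intervals closed on the right, whereas the hold jumps at
the right endpoint; the two agree off that single point. -/
theorem hold_ae_eq {p : ℝ} (hp : 0 < p) (u : ℕ → ℝ) (j : ℕ) :
    ∀ᵐ t : ℝ, t ∈ Set.uIoc ((j : ℝ) * p) (((j + 1 : ℕ) : ℝ) * p) → hold p u t = u j := by
  have h : ∀ᵐ t : ℝ, t ≠ ((j + 1 : ℕ) : ℝ) * p := by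
    rw [ae_iff]; simp
  filter_upwards [h] with t ht hmem
  rw [Set.uIoc_of_le (by push_cast; nlinarith)] at hmem
  have h2 := lt_of_le_of_ne hmem.2 ht
  push_cast at h2
  exact hold_of_mem hp u j hmem.1.le h2

open scoped Matrix.Norms.Operator in
theorem SISO.continuous_exp (G : SISO) : Continuous fun s : ℝ => NormedSpace.exp (s • G.A) :=
  (differentiable_exp_smul_const ℝ G.A).continuous

/-- The semigroup law writes the exponential at time `i * p + s` as a power of the one-step matrix
times the exponential at time `s`. This identifies the impulse response of the discretization with
the kernel integrated over one period. -/
theorem SISO.integral_ctKernel (G : SISO) (p : ℝ) (i : ℕ) :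
    ∫ s in (i * p)..((i + 1) * p), G.ctKernel s =
      (G.discretize p).C ⬝ᵥ ((G.discretize p).A ^ i *ᵥ (G.discretize p).B) := by
  have h1 : ∫ s in (i * p)..((i + 1) * p), G.ctKernel s =
      ∫ s in (0 : ℝ)..p, G.ctKernel (i * p + s) := by
    rw [intervalIntegral.integral_comp_add_left (fun s => G.ctKernel s)]
    congr 1 <;> ring
  have h2 : ∀ s : ℝ, G.ctKernel (i * p + s) =
      ∑ j, (G.C ᵥ* NormedSpace.exp (p • G.A) ^ i) j * (NormedSpace.exp (s • G.A) *ᵥ G.B) j := by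
    intro s
    have h3 : (i * p + s) • G.A = i • (p • G.A) + s • G.A := by
      rw [← Nat.cast_smul_eq_nsmul ℝ, smul_smul, ← add_smul]
    have hcm : Commute (i • (p • G.A)) (s • G.A) :=
      (((Commute.refl G.A).smul_right _).smul_left _).smul_left _
    rw [SISO.ctKernel, h3, Matrix.exp_add_of_commute _ _ hcm, Matrix.exp_nsmul,
      ← Matrix.mulVec_mulVec, Matrix.dotProduct_mulVec]
    rfl
  have hc : ∀ j, Continuous fun s : ℝ => (NormedSpace.exp (s • G.A) *ᵥ G.B) j := fun j =>
    (continuous_apply j).comp (G.continuous_exp.matrix_mulVec continuous_const)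
  rw [h1]
  simp_rw [h2]
  rw [intervalIntegral.integral_finsetSum
    (fun j _ => ((hc j).const_mul _).intervalIntegrable _ _)]
  simp_rw [intervalIntegral.integral_const_mul]
  exact (Matrix.dotProduct_mulVec _ _ _).symm

/-- Sampling the response to a held signal is the step-invariant discretization. -/
theorem SISO.sampler_ctApply_hold (G : SISO) {p : ℝ} (hp : 0 < p) (u : ℕ → ℝ) :
    sampler p (G.ctApply (hold p u)) = (G.discretize p).dtApply u := by
  funext k
  rw [SISO.dtApply_eq_sum, sampler, SISO.ctApply, hold_mul hp]
  congr 1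
  have hae : ∀ j : ℕ, ∀ᵐ s : ℝ, s ∈ Set.uIoc ((j : ℝ) * p) (((j + 1 : ℕ) : ℝ) * p) →
      G.ctKernel (k * p - s) * hold p u s = G.ctKernel (k * p - s) * u j := fun j => by
    filter_upwards [hold_ae_eq hp u j] with s hs hmem
    rw [hs hmem]
  have hcont : ∀ j : ℕ, Continuous fun s : ℝ => G.ctKernel (k * p - s) * u j := fun j =>
    (G.continuous_ctKernel.comp (continuous_const.sub continuous_id)).mul continuous_const
  have hint : ∀ j < k, IntervalIntegrable (fun s => G.ctKernel (k * p - s) * hold p u s) volume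
      ((j : ℝ) * p) (((j + 1 : ℕ) : ℝ) * p) := fun j _ =>
    ((hcont j).intervalIntegrable _ _).congr_ae (by
      rw [EventuallyEq, ae_restrict_iff' measurableSet_uIoc]
      filter_upwards [hae j] with s hs hmem using (hs hmem).symm)
  have hsum := intervalIntegral.sum_integral_adjacent_intervals
    (a := fun j : ℕ => (j : ℝ) * p) hint
  simp only [Nat.cast_zero, zero_mul] at hsum
  change ∫ s in (0 : ℝ)..(k * p), G.ctKernel (k * p - s) * hold p u s = _
  rw [← hsum]
  refine Finset.sum_congr rfl fun j hj => ?_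
  have hj' := Finset.mem_range.1 hj
  -- Seen from time `k * p`, the reflected `j`-th interval is the one with index `k - 1 - j`, which
  -- is the lag of `u j` in the convolution sum.
  rw [intervalIntegral.integral_congr_ae (hae j), intervalIntegral.integral_mul_const,
    intervalIntegral.integral_comp_sub_left (fun s => G.ctKernel s), ← G.integral_ctKernel]
  have e : ((k - 1 - j : ℕ) : ℝ) = k - 1 - j := by
    rw [Nat.cast_sub (by omega), Nat.cast_sub (by omega)]; simp
  rw [e]
  congr 2 <;> push_cast <;> ring

end Discretization

/-! ### Energies, Schur's test and `ℓ²` bounds -/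

section Energy

/-- Schur's test on `L²` for kernels with uniformly bounded marginals. -/
theorem lintegral_sq_kernel_le {α β : Type*} [MeasurableSpace α] [MeasurableSpace β]
    (μ : Measure α) (ν : Measure β) [SFinite μ] [SFinite ν] (k : α → β → ℝ≥0∞)
    (hk : Measurable (Function.uncurry k)) (f : β → ℝ≥0∞) (hf : AEMeasurable f ν) (a b : ℝ≥0∞)
    (ha : ∀ t, ∫⁻ s, k t s ∂ν ≤ a) (hb : ∀ s, ∫⁻ t, k t s ∂μ ≤ b) :
    ∫⁻ t, (∫⁻ s, k t s * f s ∂ν) ^ 2 ∂μ ≤ a * b * ∫⁻ s, f s ^ 2 ∂ν := by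
  have hkt : ∀ t, Measurable (k t) := fun t => hk.of_uncurry_left
  have hpt : ∀ t, (∫⁻ s, k t s * f s ∂ν) ^ 2 ≤ a * ∫⁻ s, k t s * f s ^ 2 ∂ν := by
    intro t
    -- Cauchy–Schwarz after splitting the kernel as the square of its root: one root carries the row
    -- bound `a`, the other stays with `f`.
    have h := ENNReal.lintegral_mul_le_Lp_mul_Lq ν Real.HolderConjugate.two_two
      (f := fun s => k t s ^ (1 / 2 : ℝ)) (g := fun s => k t s ^ (1 / 2 : ℝ) * f s)
      ((hkt t).pow_const _).aemeasurable (((hkt t).pow_const _).aemeasurable.mul hf)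
    have hsq : ∀ x : ℝ≥0∞, (x ^ (1 / 2 : ℝ)) ^ 2 = x := fun x => by
      rw [← ENNReal.rpow_natCast, ← ENNReal.rpow_mul]; norm_num
    have e1 : ∀ s, ((fun s => k t s ^ (1 / 2 : ℝ)) * fun s => k t s ^ (1 / 2 : ℝ) * f s) s =
        k t s * f s := fun s => by
      simp only [Pi.mul_apply]
      rw [← mul_assoc, ← pow_two, hsq]
    simp only [e1, ENNReal.rpow_ofNat, mul_pow, hsq] at h
    calc (∫⁻ s, k t s * f s ∂ν) ^ 2
        ≤ ((∫⁻ s, k t s ∂ν) ^ (1 / 2 : ℝ) * (∫⁻ s, k t s * f s ^ 2 ∂ν) ^ (1 / 2 : ℝ)) ^ 2 := by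
          gcongr
      _ = (∫⁻ s, k t s ∂ν) * ∫⁻ s, k t s * f s ^ 2 ∂ν := by rw [mul_pow, hsq, hsq]
      _ ≤ _ := by gcongr; exact ha t
  have hmeas : AEMeasurable (Function.uncurry fun t s => k t s * f s ^ 2) (μ.prod ν) :=
    hk.aemeasurable.mul ((hf.pow_const 2).comp_snd)
  calc ∫⁻ t, (∫⁻ s, k t s * f s ∂ν) ^ 2 ∂μ
      ≤ ∫⁻ t, a * ∫⁻ s, k t s * f s ^ 2 ∂ν ∂μ := lintegral_mono hpt
    _ = a * ∫⁻ t, ∫⁻ s, k t s * f s ^ 2 ∂ν ∂μ := by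
        exact lintegral_const_mul'' _ hmeas.lintegral_prod_right'
    _ = a * ∫⁻ s, ∫⁻ t, k t s * f s ^ 2 ∂μ ∂ν := by rw [lintegral_lintegral_swap hmeas]
    _ = a * ∫⁻ s, (∫⁻ t, k t s ∂μ) * f s ^ 2 ∂ν := by
        congr 1
        refine lintegral_congr fun s => ?_
        rw [lintegral_mul_const _ hk.of_uncurry_right]
    _ ≤ a * ∫⁻ s, b * f s ^ 2 ∂ν := by
        gcongr with s
        exact hb s
    _ = a * b * ∫⁻ s, f s ^ 2 ∂ν := by
        rw [lintegral_const_mul'' _ (hf.pow_const 2), mul_assoc]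

/-- The slack is the square `(η * a - b) ^ 2 * η⁻¹`. This replaces the triangle inequality for
squared norms: as `η → 0` the factor of the main term tends to `1`, while the factor of the
perturbation stays finite for each fixed `η`. -/
theorem enorm_add_sq_le (a b : ℝ) {η : ℝ} (hη : 0 < η) :
    ‖a + b‖ₑ ^ 2 ≤ ENNReal.ofReal (1 + η) * ‖a‖ₑ ^ 2 + ENNReal.ofReal (1 + η⁻¹) * ‖b‖ₑ ^ 2 := by
  simp only [← ofReal_norm, ← ENNReal.ofReal_pow (norm_nonneg _)]
  rw [← ENNReal.ofReal_mul (by positivity), ← ENNReal.ofReal_mul (by positivity),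
    ← ENNReal.ofReal_add (by positivity) (by positivity)]
  refine ENNReal.ofReal_le_ofReal ?_
  simp only [Real.norm_eq_abs, sq_abs]
  have h : (a + b) ^ 2 + (η * a - b) ^ 2 * η⁻¹ = (1 + η) * a ^ 2 + (1 + η⁻¹) * b ^ 2 := by
    field_simp
    ring
  have : 0 ≤ (η * a - b) ^ 2 * η⁻¹ := by positivity
  linarith

/-- A function agrees on `[0, ∞)` with a measurable one. -/
def MeasurableOnIci (f : ℝ → ℝ) : Prop := ∃ g : ℝ → ℝ, Measurable g ∧ ∀ t, 0 ≤ t → f t = g t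

theorem _root_.Measurable.measurableOnIci {f : ℝ → ℝ} (hf : Measurable f) : MeasurableOnIci f :=
  ⟨f, hf, fun _ _ => rfl⟩

theorem MeasurableOnIci.sub {f g : ℝ → ℝ} (hf : MeasurableOnIci f) (hg : MeasurableOnIci g) :
    MeasurableOnIci fun t => f t - g t := by
  obtain ⟨f', hf1, hf2⟩ := hf
  obtain ⟨g', hg1, hg2⟩ := hg
  exact ⟨fun t => f' t - g' t, hf1.sub hg1, fun t ht => by simp only [hf2 t ht, hg2 t ht]⟩

theorem MeasurableOnIci.const_mul {f : ℝ → ℝ} (hf : MeasurableOnIci f) (c : ℝ) :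
    MeasurableOnIci fun t => c * f t := by
  obtain ⟨f', hf1, hf2⟩ := hf
  exact ⟨fun t => c * f' t, hf1.const_mul c, fun t ht => by simp only [hf2 t ht]⟩

theorem MeasurableOnIci.delay {f : ℝ → ℝ} (hf : MeasurableOnIci f) (L : ℝ) :
    MeasurableOnIci (delay L f) := by
  obtain ⟨g, hg1, hg2⟩ := hf
  refine ⟨fun t => if L ≤ t then g (t - L) else 0, ?_, fun t ht => ?_⟩
  · exact Measurable.ite measurableSet_Ici (hg1.comp (measurable_id.sub_const L)) measurable_const
  · simp only [CommSystem.delay]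
    split_ifs with h
    · exact hg2 _ (sub_nonneg.2 h)
    · rfl

theorem measurable_hold (p : ℝ) (v : ℕ → ℝ) : Measurable (hold p v) :=
  Measurable.ite measurableSet_Ici
    ((measurable_of_countable v).comp (Nat.measurable_floor.comp (measurable_id.div_const p)))
    measurable_const

theorem MeasurableOnIci.aemeasurable {f : ℝ → ℝ} (hf : MeasurableOnIci f) :
    AEMeasurable f (volume.restrict (Set.Ici 0)) := by
  obtain ⟨g, hg1, hg2⟩ := hf
  exact ⟨g, hg1, (ae_restrict_mem measurableSet_Ici).mono fun t ht => hg2 t ht⟩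

theorem ctEnergy_congr {f g : ℝ → ℝ} (h : ∀ t, 0 ≤ t → f t = g t) : ctEnergy f = ctEnergy g :=
  setLIntegral_congr_fun measurableSet_Ici fun t ht => by simp only [h t ht]

theorem ctEnergy_add_le {f g : ℝ → ℝ} (hf : AEMeasurable f (volume.restrict (Set.Ici 0)))
    {η : ℝ} (hη : 0 < η) : ctEnergy (fun t => f t + g t) ≤
      ENNReal.ofReal (1 + η) * ctEnergy f + ENNReal.ofReal (1 + η⁻¹) * ctEnergy g := by
  have hm : AEMeasurable (fun t => ‖f t‖ₑ ^ 2) (volume.restrict (Set.Ici 0)) :=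
    hf.enorm.pow_const 2
  calc ctEnergy (fun t => f t + g t)
      ≤ ∫⁻ t in Set.Ici (0 : ℝ), (ENNReal.ofReal (1 + η) * ‖f t‖ₑ ^ 2 +
          ENNReal.ofReal (1 + η⁻¹) * ‖g t‖ₑ ^ 2) :=
        lintegral_mono fun t => enorm_add_sq_le _ _ hη
    _ = _ := by
        rw [lintegral_add_left' (hm.const_mul _), lintegral_const_mul'' _ hm,
          lintegral_const_mul' _ _ ENNReal.ofReal_ne_top]
        rfl

theorem ctEnergy_const_mul (c : ℝ) (f : ℝ → ℝ) :
    ctEnergy (fun t => c * f t) = ‖c‖ₑ ^ 2 * ctEnergy f := by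
  simp only [ctEnergy, enorm_mul, mul_pow]
  rw [lintegral_const_mul' _ _ (by simp)]

theorem ctEnergy_neg (f : ℝ → ℝ) : ctEnergy (fun t => -f t) = ctEnergy f := by
  simp only [ctEnergy, enorm_neg]

theorem ofReal_one_add_one : ENNReal.ofReal (1 + 1) = 2 := by
  rw [ENNReal.ofReal_add zero_le_one zero_le_one, ENNReal.ofReal_one, one_add_one_eq_two]

theorem ctEnergy_add_le_two {f g : ℝ → ℝ} (hf : AEMeasurable f (volume.restrict (Set.Ici 0))) :
    ctEnergy (fun t => f t + g t) ≤ 2 * ctEnergy f + 2 * ctEnergy g := by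
  have := ctEnergy_add_le (g := g) hf one_pos
  rwa [inv_one, ofReal_one_add_one] at this

theorem ctEnergy_sub_le_two {f g : ℝ → ℝ} (hf : AEMeasurable f (volume.restrict (Set.Ici 0))) :
    ctEnergy (fun t => f t - g t) ≤ 2 * ctEnergy f + 2 * ctEnergy g := by
  have := ctEnergy_add_le_two (g := fun t => -g t) hf
  rw [ctEnergy_neg] at this
  exact this

/-- On `[0, ∞)` the delayed signal is dominated by a translate of the extension of `f` by zero, and
Lebesgue measure is translation invariant. For negative `L` an initial piece of `f` is lost, so only
an inequality holds. -/
theorem ctEnergy_delay_le (f : ℝ → ℝ) (L : ℝ) :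
    ctEnergy (delay L f) ≤ ctEnergy f := by
  have h1 : ctEnergy (delay L f) ≤
      ∫⁻ t, (Set.Ici (0 : ℝ)).indicator (fun t => ‖f t‖ₑ ^ 2) (t - L) := by
    refine (lintegral_mono fun t => ?_).trans (setLIntegral_le_lintegral (Set.Ici 0) _)
    rw [CommSystem.delay]
    split_ifs with h
    · rw [Set.indicator_of_mem (by simpa using h)]
    · simp
  rw [lintegral_sub_right_eq_self (fun t => (Set.Ici (0 : ℝ)).indicator (fun t => ‖f t‖ₑ ^ 2) t),
    lintegral_indicator measurableSet_Ici] at h1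
  exact h1

/-- The half-open sampling intervals tile `[0, ∞)` and the hold is constant on each. This identity
is the origin of the weight `N / h` in the discrete norms. -/
theorem ctEnergy_hold {p : ℝ} (hp : 0 < p) (v : ℕ → ℝ) :
    ctEnergy (hold p v) = ENNReal.ofReal p * dtEnergy v := by
  have hU : Set.Ici (0 : ℝ) = ⋃ k : ℕ, Set.Ico ((k : ℝ) * p) ((k + 1) * p) := by
    ext t
    simp only [Set.mem_Ici, Set.mem_iUnion, Set.mem_Ico]
    refine ⟨fun ht => ⟨⌊t / p⌋₊, ?_, ?_⟩, fun ⟨k, h1, _⟩ => le_trans (by positivity) h1⟩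
    · exact (le_div_iff₀ hp).1 (Nat.floor_le (by positivity))
    · exact (div_lt_iff₀ hp).1 (Nat.lt_floor_add_one _)
  have hd : Pairwise (Function.onFun Disjoint
      fun k : ℕ => Set.Ico ((k : ℝ) * p) ((k + 1) * p)) := by
    intro i j hij
    refine Set.disjoint_left.2 fun t h1 h2 => hij ?_
    have a1 : (i : ℝ) < j + 1 := lt_of_mul_lt_mul_right (h1.1.trans_lt h2.2) hp.le
    have a2 : (j : ℝ) < i + 1 := lt_of_mul_lt_mul_right (h2.1.trans_lt h1.2) hp.le
    have b1 : i < j + 1 := by exact_mod_cast a1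
    have b2 : j < i + 1 := by exact_mod_cast a2
    omega
  rw [ctEnergy, hU, lintegral_iUnion (fun _ => measurableSet_Ico) hd, dtEnergy,
    ← ENNReal.tsum_mul_left]
  refine tsum_congr fun k => ?_
  rw [setLIntegral_congr_fun (g := fun _ => ‖v k‖ₑ ^ 2) measurableSet_Ico
    (fun t ht => by simp only [hold_of_mem hp v k ht.1 ht.2]), setLIntegral_const, Real.volume_Ico,
    mul_comm]
  congr 2
  ring

theorem dtEnergy_add_le (u v : ℕ → ℝ) {η : ℝ} (hη : 0 < η) : dtEnergy (fun k => u k + v k) ≤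
    ENNReal.ofReal (1 + η) * dtEnergy u + ENNReal.ofReal (1 + η⁻¹) * dtEnergy v := by
  simp only [dtEnergy, ← ENNReal.tsum_mul_left]
  rw [← ENNReal.tsum_add]
  exact ENNReal.tsum_le_tsum fun k => enorm_add_sq_le _ _ hη

theorem dtEnergy_add_le_two (u v : ℕ → ℝ) :
    dtEnergy (fun k => u k + v k) ≤ 2 * dtEnergy u + 2 * dtEnergy v := by
  have := dtEnergy_add_le u v one_pos
  rwa [inv_one, ofReal_one_add_one] at this

theorem dtEnergy_downsample_le {M : ℕ} (hM : 0 < M) (v : ℕ → ℝ) :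
    dtEnergy (downsample M v) ≤ dtEnergy v :=
  ENNReal.tsum_comp_le_tsum_of_injective (f := fun k : ℕ => k * M)
    (fun _ _ h => Nat.eq_of_mul_eq_mul_right hM h) fun k => ‖v k‖ₑ ^ 2

theorem dtEnergy_upsample_le (M : ℕ) (v : ℕ → ℝ) :
    dtEnergy (upsample M v) ≤ dtEnergy v := by
  have h1 : ∀ k, ‖upsample M v k‖ₑ ^ 2 =
      {k | M ∣ k}.indicator (fun k => ‖v (k / M)‖ₑ ^ 2) k := fun k => by
    by_cases h : M ∣ k <;> simp [upsample, h]
  rw [dtEnergy, tsum_congr h1, ← tsum_subtype {k | M ∣ k} (fun k => ‖v (k / M)‖ₑ ^ 2)]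
  refine ENNReal.tsum_comp_le_tsum_of_injective (f := fun k : {k | M ∣ k} => (k : ℕ) / M)
    (fun a b h => ?_) fun k => ‖v k‖ₑ ^ 2
  have ha := Nat.div_mul_cancel a.2
  have hb := Nat.div_mul_cancel b.2
  simp only at h
  exact Subtype.ext (by rw [← ha, ← hb, h])

/-- Column sums of a causal Toeplitz matrix; `tsum_reflect_le` treats its rows. Together they are
the hypotheses of Schur's test for discrete convolution. -/
theorem tsum_shift_le (q : ℕ → ℝ≥0∞) (j : ℕ) :
    ∑' k, (if j ≤ k then q (k - j) else 0) ≤ ∑' i, q i := by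
  have h1 : ∀ k, (if j ≤ k then q (k - j) else 0) =
      {k | j ≤ k}.indicator (fun k => q (k - j)) k := fun k => by
    by_cases h : j ≤ k <;> simp [h]
  rw [tsum_congr h1, ← tsum_subtype {k | j ≤ k} (fun k => q (k - j))]
  refine ENNReal.tsum_comp_le_tsum_of_injective (f := fun k : {k | j ≤ k} => (k : ℕ) - j)
    (fun a b h => ?_) q
  have ha : j ≤ a := a.2
  have hb : j ≤ b := b.2
  simp only at h
  exact Subtype.ext (by omega)

theorem tsum_reflect_le (q : ℕ → ℝ≥0∞) (k : ℕ) :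
    ∑' j, (if j ≤ k then q (k - j) else 0) ≤ ∑' i, q i := by
  have h1 : ∀ j, (if j ≤ k then q (k - j) else 0) =
      {j | j ≤ k}.indicator (fun j => q (k - j)) j := fun j => by
    by_cases h : j ≤ k <;> simp [h]
  rw [tsum_congr h1, ← tsum_subtype {j | j ≤ k} (fun j => q (k - j))]
  refine ENNReal.tsum_comp_le_tsum_of_injective (f := fun j : {j | j ≤ k} => k - (j : ℕ))
    (fun a b h => ?_) q
  have ha : a ≤ k := a.2
  have hb : b ≤ k := b.2
  simp only at h
  exact Subtype.ext (by omega)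

/-- Young's inequality `ℓ¹ * ℓ² ⊆ ℓ²` for causal kernels. -/
theorem dtEnergy_le_of_kernel (y u : ℕ → ℝ) (q : ℕ → ℝ≥0∞)
    (h : ∀ k, ‖y k‖ₑ ≤ ∑' j, (if j ≤ k then q (k - j) else 0) * ‖u j‖ₑ) :
    dtEnergy y ≤ (∑' i, q i) ^ 2 * dtEnergy u := by
  have := lintegral_sq_kernel_le (Measure.count (α := ℕ)) (Measure.count (α := ℕ))
    (fun k j => if j ≤ k then q (k - j) else 0) (measurable_of_countable _) (fun j => ‖u j‖ₑ)
    (measurable_of_countable _).aemeasurable (∑' i, q i) (∑' i, q i)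
    (fun k => by rw [lintegral_count]; exact tsum_reflect_le q k)
    (fun j => by rw [lintegral_count]; exact tsum_shift_le q j)
  simp only [lintegral_count] at this
  rw [pow_two]
  exact (ENNReal.tsum_le_tsum fun k => pow_le_pow_left' (h k) 2).trans this

/-- Stable discrete-time systems are bounded on `ℓ²`. -/
theorem SISO.DTStable.exists_dtEnergy_le {G : SISO} (hG : G.DTStable) :
    ∃ K : ℝ≥0∞, K < ∞ ∧ ∀ u, dtEnergy (G.dtApply u) ≤ K * dtEnergy u := by
  obtain ⟨K, ρ, hK, hρ, hρ1, hb⟩ := G.exists_pow_bound hG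
  -- The impulse response is `D` at lag `0` and involves `A ^ (i - 1)` at lag `i ≥ 1`. Shifting the
  -- exponent costs the factor `1 / ρ`, and then `c * ρ ^ i` dominates every lag.
  set c := K / ρ + |G.D| with hc
  have hc0 : 0 ≤ c := by positivity
  set q : ℕ → ℝ≥0∞ := fun i => ENNReal.ofReal (c * ρ ^ i) with hq
  have hsum : Summable fun i : ℕ => c * ρ ^ i :=
    (summable_geometric_of_lt_one hρ.le hρ1).mul_left c
  have hfin : ∑' i, q i < ∞ := by
    rw [hq, ← ENNReal.ofReal_tsum_of_nonneg (fun i => by positivity) hsum]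
    exact ENNReal.ofReal_lt_top
  refine ⟨(∑' i, q i) ^ 2, ENNReal.pow_lt_top hfin, fun u => dtEnergy_le_of_kernel _ _ q
    fun k => ?_⟩
  have h1 : ∀ j, (if j ≤ k then q (k - j) else 0) * ‖u j‖ₑ =
      {j | j ≤ k}.indicator (fun j => q (k - j) * ‖u j‖ₑ) j := fun j => by
    by_cases h : j ≤ k <;> simp [h]
  rw [G.dtApply_eq_sum]
  calc ‖∑ j ∈ Finset.range k, (G.C ⬝ᵥ (G.A ^ (k - 1 - j) *ᵥ G.B)) * u j + G.D * u k‖ₑ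
      ≤ ∑ j ∈ Finset.range k, ‖(G.C ⬝ᵥ (G.A ^ (k - 1 - j) *ᵥ G.B)) * u j‖ₑ + ‖G.D * u k‖ₑ :=
        (enorm_add_le _ _).trans (by gcongr; exact enorm_sum_le _ _)
    _ ≤ ∑ j ∈ Finset.range k, q (k - j) * ‖u j‖ₑ + q (k - k) * ‖u k‖ₑ := by
        simp only [enorm_mul]
        gcongr with j hj
        · have hj' := Finset.mem_range.1 hj
          rw [← ofReal_norm, Real.norm_eq_abs]
          refine ENNReal.ofReal_le_ofReal ((hb _).trans ?_)
          have e : k - j = (k - 1 - j) + 1 := by omega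
          rw [e, pow_succ]
          have : K * ρ ^ (k - 1 - j) = (K / ρ) * (ρ ^ (k - 1 - j) * ρ) := by field_simp
          rw [this]
          gcongr
          rw [hc]
          linarith [abs_nonneg G.D]
        · rw [← ofReal_norm, Real.norm_eq_abs, Nat.sub_self]
          refine ENNReal.ofReal_le_ofReal ?_
          rw [pow_zero, mul_one, hc]
          have : 0 ≤ K / ρ := by positivity
          linarith
    _ = ∑ j ∈ Finset.range (k + 1), (if j ≤ k then q (k - j) else 0) * ‖u j‖ₑ := by
        rw [Finset.sum_range_succ, if_pos le_rfl]
        congr 1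
        refine Finset.sum_congr rfl fun j hj => ?_
        rw [if_pos (Finset.mem_range.1 hj).le]
    _ ≤ _ := ENNReal.sum_le_tsum _

end Energy

/-! ### Convolution with exponentially decaying kernels -/

section Convolution

theorem IsL2.intervalIntegrable {w : ℝ → ℝ} (hw : IsL2 w) {a b : ℝ} (ha : 0 ≤ a) (hb : 0 ≤ b) :
    IntervalIntegrable w volume a b := by
  rw [intervalIntegrable_iff]
  have hsub : Set.uIoc a b ⊆ Set.Ici 0 := fun t ht => (le_min ha hb).trans ht.1.le
  have h1 : MemLp w 2 (volume.restrict (Set.uIoc a b)) :=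
    MemLp.mono_measure (Measure.restrict_mono hsub le_rfl) hw
  have : IsFiniteMeasure (volume.restrict (Set.uIoc a b)) :=
    ⟨by rw [Measure.restrict_apply_univ, Set.uIoc]; exact measure_Ioc_lt_top⟩
  exact h1.integrable one_le_two

/-- Continuous-time response without the feedthrough term. -/
def SISO.conv (G : SISO) (w : ℝ → ℝ) (t : ℝ) : ℝ := ∫ s in (0 : ℝ)..t, G.ctKernel (t - s) * w s

theorem SISO.ctApply_eq (G : SISO) (w : ℝ → ℝ) (t : ℝ) :
    G.ctApply w t = G.conv w t + G.D * w t := rfl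

theorem SISO.intervalIntegrable_kernel_mul (G : SISO) {w : ℝ → ℝ} (hw : IsL2 w) (t : ℝ) {a b : ℝ}
    (ha : 0 ≤ a) (hb : 0 ≤ b) :
    IntervalIntegrable (fun s => G.ctKernel (t - s) * w s) volume a b :=
  (hw.intervalIntegrable ha hb).continuousOn_mul
    (G.continuous_ctKernel.comp (continuous_const.sub continuous_id)).continuousOn

theorem SISO.conv_sub (G : SISO) {w v : ℝ → ℝ} (hw : IsL2 w) (hv : IsL2 v) {t : ℝ} (ht : 0 ≤ t) :
    G.conv (fun s => w s - v s) t = G.conv w t - G.conv v t := by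
  simp only [SISO.conv, mul_sub]
  exact intervalIntegral.integral_sub (G.intervalIntegrable_kernel_mul hw t le_rfl ht)
    (G.intervalIntegrable_kernel_mul hv t le_rfl ht)

/-- The convolution is a parameter integral of a jointly measurable function once `w` is replaced by
a measurable version. This works only for `t ≥ 0`: for negative `t` the interval integral runs
backwards, over values of `w` that are not controlled. -/
theorem SISO.measurableOnIci_conv (G : SISO) {w : ℝ → ℝ} (hw : IsL2 w) :
    MeasurableOnIci (G.conv w) := by
  have hsm := hw.1
  set v := hsm.mk w with hv
  have hvm : Measurable v := hsm.stronglyMeasurable_mk.measurable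
  have hset : MeasurableSet {x : ℝ × ℝ | 0 < x.2 ∧ x.2 ≤ x.1} :=
    (measurableSet_lt measurable_const measurable_snd).inter
      (measurableSet_le measurable_snd measurable_fst)
  refine ⟨fun t => ∫ s, {x : ℝ × ℝ | 0 < x.2 ∧ x.2 ≤ x.1}.indicator
    (fun x => G.ctKernel (x.1 - x.2) * v x.2) (t, s), ?_, fun t ht => ?_⟩
  · refine (StronglyMeasurable.integral_prod_right' ?_).measurable
    exact (((G.continuous_ctKernel.measurable.comp (measurable_fst.sub measurable_snd)).mul
      (hvm.comp measurable_snd)).indicator hset).stronglyMeasurable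
  · have e : ∀ s, {x : ℝ × ℝ | 0 < x.2 ∧ x.2 ≤ x.1}.indicator
        (fun x => G.ctKernel (x.1 - x.2) * v x.2) (t, s) =
        (Set.Ioc 0 t).indicator (fun s => G.ctKernel (t - s) * v s) s := fun s => by
      simp only [Set.indicator, Set.mem_ofPred_eq, Set.mem_Ioc]
    simp only [e]
    rw [integral_indicator measurableSet_Ioc, SISO.conv, intervalIntegral.integral_of_le ht]
    refine integral_congr_ae ?_
    have hsub : Set.Ioc 0 t ⊆ Set.Ici (0 : ℝ) := fun s hs => hs.1.le
    filter_upwards [ae_mono (Measure.restrict_mono hsub le_rfl) hsm.ae_eq_mk] with s hs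
    rw [hs]

/-- Young's inequality `L¹ * L² ⊆ L²` on the half line. -/
theorem ctEnergy_le_of_kernel {f w : ℝ → ℝ} (hw : IsL2 w) {q : ℝ → ℝ≥0∞} (hq : Measurable q)
    (h : ∀ t, 0 ≤ t → ‖f t‖ₑ ≤ ∫⁻ s in Set.Ici 0, q (t - s) * ‖w s‖ₑ) :
    ctEnergy f ≤ (∫⁻ u, q u) ^ 2 * ctEnergy w := by
  have := lintegral_sq_kernel_le (volume.restrict (Set.Ici (0 : ℝ)))
    (volume.restrict (Set.Ici (0 : ℝ))) (fun t s => q (t - s))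
    (hq.comp (measurable_fst.sub measurable_snd)) (fun s => ‖w s‖ₑ) hw.1.enorm
    (∫⁻ u, q u) (∫⁻ u, q u)
    (fun t => (setLIntegral_le_lintegral _ _).trans (lintegral_sub_left_eq_self q t).le)
    (fun s => (setLIntegral_le_lintegral _ _).trans (lintegral_sub_right_eq_self q s).le)
  rw [pow_two (∫⁻ u, q u)]
  refine le_trans (lintegral_mono_ae ?_) this
  filter_upwards [ae_restrict_mem measurableSet_Ici] with t ht
  exact pow_le_pow_left' (h t ht) 2

/-- The kernel `u ↦ c e^{-r u}` on `[0, ∞)`. -/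
def expKernel (c r u : ℝ) : ℝ≥0∞ :=
  (Set.Ici (0 : ℝ)).indicator (fun u => ENNReal.ofReal (c * Real.exp (-(r * u)))) u

theorem measurable_expKernel (c r : ℝ) : Measurable (expKernel c r) :=
  Measurable.indicator (by fun_prop) measurableSet_Ici

theorem expKernel_of_nonneg (c r : ℝ) {u : ℝ} (hu : 0 ≤ u) :
    expKernel c r u = ENNReal.ofReal (c * Real.exp (-(r * u))) :=
  Set.indicator_of_mem (s := Set.Ici (0 : ℝ)) hu _

theorem lintegral_expKernel {c r : ℝ} (hc : 0 ≤ c) (hr : 0 < r) :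
    ∫⁻ u, expKernel c r u = ENNReal.ofReal (c / r) := by
  have hint : IntegrableOn (fun u => c * Real.exp (-(r * u))) (Set.Ioi 0) := by
    have := (exp_neg_integrableOn_Ioi 0 hr).const_mul c
    simp only [neg_mul] at this
    exact this
  have hval : ∫ u in Set.Ioi (0 : ℝ), c * Real.exp (-(r * u)) = c / r := by
    have := integral_exp_mul_Ioi (a := -r) (by linarith) 0
    rw [integral_const_mul]
    simp only [neg_mul] at this
    rw [this]
    simp [div_eq_mul_inv]
  simp only [expKernel]
  rw [lintegral_indicator measurableSet_Ici, setLIntegral_congr Ioi_ae_eq_Ici.symm,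
    ← ofReal_integral_eq_lintegral_ofReal hint (ae_of_all _ fun u => by positivity), hval]

theorem enorm_intervalIntegral_le {f w : ℝ → ℝ} {q : ℝ → ℝ≥0∞} {a b : ℝ} (hab : a ≤ b)
    (h : ∀ s, a < s → s ≤ b → ‖f s‖ₑ ≤ q s * ‖w s‖ₑ) :
    ‖∫ s in a..b, f s‖ₑ ≤ ∫⁻ s in Set.Ioc a b, q s * ‖w s‖ₑ := by
  rw [intervalIntegral.integral_of_le hab]
  refine (enorm_integral_le_lintegral_enorm _).trans (lintegral_mono_ae ?_)
  filter_upwards [ae_restrict_mem measurableSet_Ioc] with s hs using h s hs.1 hs.2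

theorem enorm_le_ofReal_of_abs_le {x c : ℝ} (h : |x| ≤ c) : ‖x‖ₑ ≤ ENNReal.ofReal c := by
  rw [← ofReal_norm]
  exact ENNReal.ofReal_le_ofReal h

theorem SISO.CTStable.exists_ctEnergy_conv_le {G : SISO} (hG : G.CTStable) :
    ∃ K : ℝ≥0∞, K < ∞ ∧ ∀ w, IsL2 w → ctEnergy (G.conv w) ≤ K * ctEnergy w := by
  obtain ⟨c, r, hc, hr, hb, -⟩ := G.exists_ctKernel_bound hG
  refine ⟨(∫⁻ u, expKernel c r u) ^ 2, ?_, fun w hw =>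
    ctEnergy_le_of_kernel hw (measurable_expKernel c r) fun t ht => ?_⟩
  · rw [lintegral_expKernel hc.le hr]
    exact ENNReal.pow_lt_top ENNReal.ofReal_lt_top
  · refine (enorm_intervalIntegral_le (q := fun s => expKernel c r (t - s)) (w := w) ht
      fun s _ hs => ?_).trans (lintegral_mono_set fun s hs => hs.1.le)
    rw [enorm_mul, expKernel_of_nonneg _ _ (sub_nonneg.2 hs)]
    gcongr
    exact enorm_le_ofReal_of_abs_le (hb _ (sub_nonneg.2 hs))

/-- Holding the samples approximates the response of a stable strictly proper system, with an
error that is linear in the sampling period. -/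
theorem SISO.CTStable.exists_hold_sampler_conv_le {G : SISO} (hG : G.CTStable) (T : ℝ) :
    ∃ K : ℝ, ∀ p, 0 < p → p ≤ T → ∀ w, IsL2 w →
      ctEnergy (fun t => hold p (sampler p (G.conv w)) t - G.conv w t) ≤
        ENNReal.ofReal (K * p) ^ 2 * ctEnergy w := by
  obtain ⟨c, r, hc, hr, hb, hb'⟩ := G.exists_ctKernel_bound hG
  -- This constant times `p` is the `L¹` norm of the majorant `q` below.
  refine ⟨c + c * Real.exp (r * T) / r, fun p hp hpT w hw => ?_⟩
  -- The increment bound decays in the distance to the last sampling instant `a`, whereas `q` must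
  -- depend on `t - s`. Since `t - a ≤ p ≤ T`, the change costs at most `exp (r * T)`.
  set d := c * p * Real.exp (r * T) with hd
  have hd0 : 0 ≤ d := by positivity
  -- The indicator dominates the kernel on the piece `(a, t]`, which the sample at `a` does not see.
  -- The exponential dominates the kernel increment on `(0, a]`.
  set q : ℝ → ℝ≥0∞ := fun u =>
    (Set.Icc 0 p).indicator (fun _ => ENNReal.ofReal c) u + expKernel d r u with hq
  have hqm : Measurable q :=
    (measurable_const.indicator measurableSet_Icc).add (measurable_expKernel d r)
  have hqi : ∫⁻ u, q u = ENNReal.ofReal ((c + c * Real.exp (r * T) / r) * p) := by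
    rw [hq, lintegral_add_left (measurable_const.indicator measurableSet_Icc),
      lintegral_indicator measurableSet_Icc, setLIntegral_const, Real.volume_Icc, sub_zero,
      lintegral_expKernel hd0 hr, ← ENNReal.ofReal_mul hc.le,
      ← ENNReal.ofReal_add (by positivity) (by positivity), hd]
    congr 1
    ring
  rw [← hqi]
  refine ctEnergy_le_of_kernel hw hqm fun t ht => ?_
  set k := ⌊t / p⌋₊ with hk
  have hk1 : (k : ℝ) * p ≤ t := (le_div_iff₀ hp).1 (Nat.floor_le (by positivity))
  have hk2 : t < (k + 1) * p := (div_lt_iff₀ hp).1 (Nat.lt_floor_add_one _)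
  have hk0 : 0 ≤ (k : ℝ) * p := by positivity
  rw [hold_of_mem hp _ k hk1 hk2, sampler]
  set a := (k : ℝ) * p with ha
  have hta : t - a ≤ p := by rw [ha]; linarith
  have hsplit : G.conv w a - G.conv w t =
      (∫ s in (0 : ℝ)..a, (G.ctKernel (a - s) - G.ctKernel (t - s)) * w s) -
        ∫ s in a..t, G.ctKernel (t - s) * w s := by
    have h1 := intervalIntegral.integral_add_adjacent_intervals
      (G.intervalIntegrable_kernel_mul hw t le_rfl hk0)
      (G.intervalIntegrable_kernel_mul hw t hk0 ht)
    simp only [SISO.conv, sub_mul]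
    rw [intervalIntegral.integral_sub (G.intervalIntegrable_kernel_mul hw a le_rfl hk0)
      (G.intervalIntegrable_kernel_mul hw t le_rfl hk0), ← h1]
    ring
  have hI1 : ‖∫ s in (0 : ℝ)..a, (G.ctKernel (a - s) - G.ctKernel (t - s)) * w s‖ₑ ≤
      ∫⁻ s in Set.Ioc 0 a, q (t - s) * ‖w s‖ₑ := by
    refine enorm_intervalIntegral_le (q := fun s => q (t - s)) hk0 fun s _ hs => ?_
    rw [enorm_mul]
    gcongr
    refine le_trans ?_ (le_add_self)
    rw [expKernel_of_nonneg _ _ (by linarith)]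
    refine enorm_le_ofReal_of_abs_le ?_
    have h1 := hb' (a - s) (t - a) (by linarith) (by linarith)
    rw [show a - s + (t - a) = t - s by ring, abs_sub_comm] at h1
    refine h1.trans ?_
    rw [hd, mul_assoc (c * p), ← Real.exp_add]
    gcongr
    nlinarith
  have hI2 : ‖∫ s in a..t, G.ctKernel (t - s) * w s‖ₑ ≤
      ∫⁻ s in Set.Ioc a t, q (t - s) * ‖w s‖ₑ := by
    refine enorm_intervalIntegral_le (q := fun s => q (t - s)) hk1 fun s h1 h2 => ?_
    rw [enorm_mul]
    gcongr
    refine le_trans ?_ (le_self_add)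
    have hmem : t - s ∈ Set.Icc 0 p := ⟨by linarith, by linarith⟩
    rw [Set.indicator_of_mem hmem]
    refine enorm_le_ofReal_of_abs_le ((hb _ (by linarith)).trans ?_)
    refine mul_le_of_le_one_right hc.le (Real.exp_le_one_iff.2 ?_)
    nlinarith
  calc ‖G.conv w a - G.conv w t‖ₑ
      ≤ (∫⁻ s in Set.Ioc 0 a, q (t - s) * ‖w s‖ₑ) + ∫⁻ s in Set.Ioc a t, q (t - s) * ‖w s‖ₑ := by
        rw [hsplit]
        exact (enorm_sub_le).trans (add_le_add hI1 hI2)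
    _ = ∫⁻ s in Set.Ioc 0 t, q (t - s) * ‖w s‖ₑ := by
        rw [← Set.Ioc_union_Ioc_eq_Ioc hk0 hk1,
          lintegral_union measurableSet_Ioc (Set.Ioc_disjoint_Ioc_of_le le_rfl)]
    _ ≤ _ := lintegral_mono_set fun s hs => hs.1.le

/-- Sampling the response of a stable strictly proper system is bounded from `L²` to `ℓ²`. -/
theorem SISO.CTStable.exists_dtEnergy_sampler_conv_le {G : SISO} (hG : G.CTStable) {p : ℝ}
    (hp : 0 < p) :
    ∃ K : ℝ≥0∞, K < ∞ ∧ ∀ w, IsL2 w → dtEnergy (sampler p (G.conv w)) ≤ K * ctEnergy w := by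
  obtain ⟨K1, hK1, h1⟩ := hG.exists_ctEnergy_conv_le
  obtain ⟨K2, h2⟩ := hG.exists_hold_sampler_conv_le p
  have hp' : ENNReal.ofReal p ≠ 0 := by simpa using hp
  -- The energy of the samples is `1 / p` times that of their hold, and the hold is the response
  -- plus the sampling error, both bounded on `L²`.
  refine ⟨(ENNReal.ofReal p)⁻¹ * (2 * K1 + 2 * ENNReal.ofReal (K2 * p) ^ 2), ?_, fun w hw => ?_⟩
  · exact ENNReal.mul_lt_top (by simpa using hp) (by finiteness)
  · have h3 := ctEnergy_hold hp (sampler p (G.conv w))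
    have h4 : ctEnergy (hold p (sampler p (G.conv w))) ≤
        (2 * K1 + 2 * ENNReal.ofReal (K2 * p) ^ 2) * ctEnergy w := by
      have h5 := ctEnergy_add_le_two
        (g := fun t => hold p (sampler p (G.conv w)) t - G.conv w t)
        (G.measurableOnIci_conv hw).aemeasurable
      simp only [add_sub_cancel] at h5
      rw [add_mul, mul_assoc, mul_assoc]
      refine h5.trans ?_
      gcongr
      · exact h1 w hw
      · exact h2 p hp le_rfl w hw
    rw [mul_assoc]
    refine le_trans (le_of_eq ?_) (mul_le_mul_right h4 _)
    rw [h3, ← mul_assoc, ENNReal.inv_mul_cancel hp' ENNReal.ofReal_ne_top, one_mul]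

theorem SISO.dtApply_sub (G : SISO) (u v : ℕ → ℝ) (k : ℕ) :
    G.dtApply (fun j => u j - v j) k = G.dtApply u k - G.dtApply v k := by
  simp only [SISO.dtApply_eq_sum, mul_sub, Finset.sum_sub_distrib]
  ring

theorem SISO.dtApply_zero (G : SISO) (k : ℕ) : G.dtApply (fun _ => 0) k = 0 := by
  simp [SISO.dtApply_eq_sum]

end Convolution

/-! ### Algebra of hold, sampler and delay -/

section HoldSampler

theorem IsL2.ctEnergy_lt_top {w : ℝ → ℝ} (hw : IsL2 w) : ctEnergy w < ∞ := by
  have := (eLpNorm_lt_top_iff_lintegral_rpow_enorm_lt_top (by simp) (by simp)).1 hw.2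
  simpa [ctEnergy] using this

theorem MeasurableOnIci.isL2 {w : ℝ → ℝ} (hw : MeasurableOnIci w) (h : ctEnergy w < ∞) :
    IsL2 w := by
  refine ⟨hw.aemeasurable.aestronglyMeasurable, ?_⟩
  rw [eLpNorm_lt_top_iff_lintegral_rpow_enorm_lt_top (by simp) (by simp)]
  simpa [ctEnergy] using h

theorem isL2_hold {p : ℝ} (hp : 0 < p) {v : ℕ → ℝ} (hv : dtEnergy v < ∞) : IsL2 (hold p v) :=
  (measurable_hold p v).measurableOnIci.isL2 (by
    rw [ctEnergy_hold hp]
    exact ENNReal.mul_lt_top ENNReal.ofReal_lt_top hv)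

theorem IsL2.sub {w v : ℝ → ℝ} (hw : IsL2 w) (hv : IsL2 v) : IsL2 fun t => w t - v t :=
  MemLp.sub hw hv

theorem hold_apply_of_nonneg (p : ℝ) (v : ℕ → ℝ) {t : ℝ} (ht : 0 ≤ t) :
    hold p v t = v ⌊t / p⌋₊ := if_pos ht

theorem hold_sub (p : ℝ) (u v : ℕ → ℝ) (t : ℝ) :
    hold p (fun k => u k - v k) t = hold p u t - hold p v t := by
  by_cases ht : 0 ≤ t <;> simp [hold, ht]

theorem hold_mul_period {p : ℝ} (v : ℕ → ℝ) (l : ℕ) :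
    hold (l * p) v = hold p fun j => v (j / l) := by
  funext t
  by_cases ht : 0 ≤ t
  · rw [hold_apply_of_nonneg _ _ ht, hold_apply_of_nonneg _ _ ht]
    congr 1
    rw [mul_comm, ← div_div, Nat.floor_div_natCast]
  · simp [hold, ht]

theorem sampler_hold {p : ℝ} (hp : 0 < p) (v : ℕ → ℝ) : sampler p (hold p v) = v :=
  funext fun k => hold_mul hp v k

/-- A signal held on a coarser grid is constant on the cells of a refinement, so fast sampling and
holding reproduce it. This removes the feedthrough of `P` from the sampling error. -/
theorem hold_sampler_hold {p : ℝ} (hp : 0 < p) (v : ℕ → ℝ) (l : ℕ) :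
    hold p (sampler p (hold (l * p) v)) = hold (l * p) v := by
  rw [hold_mul_period, sampler_hold hp]

theorem sampler_delay {p : ℝ} (hp : 0 < p) (f : ℝ → ℝ) (j k : ℕ) :
    sampler p (delay (j * p) f) k = if j ≤ k then sampler p f (k - j) else 0 := by
  have h : (j : ℝ) * p ≤ k * p ↔ j ≤ k := by
    rw [mul_le_mul_iff_of_pos_right hp, Nat.cast_le]
  simp only [sampler, delay, h]
  split_ifs with hjk
  · rw [Nat.cast_sub hjk, sub_mul]
  · rfl

/-- A delay by whole periods maps the sampling grid to itself. It is here that the reconstruction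
delay has to be a multiple of the fast period. -/
theorem hold_sampler_delay {p : ℝ} (hp : 0 < p) (f : ℝ → ℝ) (j : ℕ) {t : ℝ} (ht : 0 ≤ t) :
    hold p (sampler p (delay (j * p) f)) t = delay (j * p) (hold p (sampler p f)) t := by
  have h : (j : ℝ) * p ≤ t ↔ j ≤ ⌊t / p⌋₊ := by
    rw [Nat.le_floor_iff (by positivity), le_div_iff₀ hp]
  rw [hold_apply_of_nonneg _ _ ht, sampler_delay hp, delay]
  simp only [h]
  split_ifs with hj
  · rw [hold_apply_of_nonneg _ _ (sub_nonneg.2 (h.2 hj)), sub_div, mul_div_cancel_right₀ _ hp.ne',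
      Nat.floor_sub_natCast]
  · rfl

theorem hold_sampler_sub (p : ℝ) (f g : ℝ → ℝ) (t : ℝ) :
    hold p (sampler p fun t => f t - g t) t = hold p (sampler p f) t - hold p (sampler p g) t :=
  hold_sub p (sampler p f) (sampler p g) t

theorem sampler_const_mul (p c : ℝ) (f : ℝ → ℝ) :
    sampler p (fun t => c * f t) = fun k => c * sampler p f k := rfl

theorem hold_const_mul (p c : ℝ) (v : ℕ → ℝ) (t : ℝ) :
    hold p (fun k => c * v k) t = c * hold p v t := by
  by_cases ht : 0 ≤ t <;> simp [hold, ht]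

end HoldSampler

/-! ### Boundedness, linearity and sampling error of the error system -/

section ErrorSystem

variable {S : Data}

/-- The received signal `ν_d`. -/
def Data.received (S : Data) (w : ℝ → ℝ) (n : ℕ → ℝ) : ℕ → ℝ :=
  fun k => S.Ch.dtApply (S.transmitted w) k + S.Wn.dtApply n k

/-- The input of the hold in the receiver. -/
def Data.filtered (S : Data) (w : ℝ → ℝ) (n : ℕ → ℝ) : ℕ → ℝ :=
  S.KR.dtApply (upsample S.M (S.received w n))

theorem Data.Admissible.ctApply_F (hS : S.Admissible) (w : ℝ → ℝ) :
    S.F.ctApply w = S.F.conv w := by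
  funext t
  rw [SISO.ctApply_eq, show S.F.D = 0 from hS.F_strictlyProper, zero_mul, add_zero]

theorem Data.Admissible.period_pos (hS : S.Admissible) : 0 < S.h / S.M :=
  div_pos hS.h_pos (Nat.cast_pos.2 hS.M_pos)

/-- Separates the strictly proper responses, whose sampling error is small, from the feedthrough
term, which jumps but is itself a hold. -/
theorem Data.errR_eq (hS : S.Admissible) (w : ℝ → ℝ) (n : ℕ → ℝ) (t : ℝ) :
    S.errR w n t = (delay S.L (S.F.conv w) t - S.P.conv (hold (S.h / S.M) (S.filtered w n)) t) -
      S.P.D * hold (S.h / S.M) (S.filtered w n) t := by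
  rw [Data.errR, hS.ctApply_F, Data.reconstructed, SISO.ctApply_eq, sub_sub]
  rfl

theorem Data.errT_eq_errR (w : ℝ → ℝ) : S.errT w = S.errR w fun _ => 0 := by
  funext t
  simp only [Data.errT, Data.errR, SISO.dtApply_zero, add_zero]

/-- Point sampling is unbounded on `L²`; it becomes bounded after the stable strictly proper
prefilter `F`. -/
theorem Data.exists_transmitted_le (hS : S.Admissible) :
    ∃ K : ℝ≥0∞, K < ∞ ∧ ∀ w, IsL2 w → dtEnergy (S.transmitted w) ≤ K * ctEnergy w := by
  obtain ⟨K1, hK1, h1⟩ := hS.F_stable.exists_dtEnergy_sampler_conv_le hS.period_pos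
  obtain ⟨K2, hK2, h2⟩ := hS.KT_stable.exists_dtEnergy_le
  refine ⟨K2 * K1, ENNReal.mul_lt_top hK2 hK1, fun w hw => ?_⟩
  rw [Data.transmitted, hS.ctApply_F, mul_assoc]
  exact (dtEnergy_downsample_le hS.M_pos _).trans
    ((h2 _).trans (mul_le_mul_right (h1 w hw) _))

theorem Data.exists_weightedT_le (hS : S.Admissible) :
    ∃ K : ℝ≥0∞, K < ∞ ∧ ∀ w, IsL2 w → dtEnergy (S.weightedT w) ≤ K * ctEnergy w := by
  obtain ⟨K1, hK1, h1⟩ := Data.exists_transmitted_le hS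
  obtain ⟨K2, hK2, h2⟩ := hS.Wz_stable.exists_dtEnergy_le
  refine ⟨K2 * K1, ENNReal.mul_lt_top hK2 hK1, fun w hw => ?_⟩
  rw [mul_assoc]
  exact (h2 _).trans (mul_le_mul_right (h1 w hw) _)

theorem Data.exists_filtered_le (hS : S.Admissible) :
    ∃ K : ℝ≥0∞, K < ∞ ∧ ∀ w n, IsL2 w →
      dtEnergy (S.filtered w n) ≤ K * (ctEnergy w + dtEnergy n) := by
  obtain ⟨K1, hK1, h1⟩ := Data.exists_transmitted_le hS
  obtain ⟨K2, hK2, h2⟩ := hS.Ch_stable.exists_dtEnergy_le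
  obtain ⟨K3, hK3, h3⟩ := hS.Wn_stable.exists_dtEnergy_le
  obtain ⟨K4, hK4, h4⟩ := hS.KR_stable.exists_dtEnergy_le
  refine ⟨K4 * (2 * (K2 * K1) + 2 * K3), by finiteness, fun w n hw => ?_⟩
  have h5 : dtEnergy (S.received w n) ≤
      (2 * (K2 * K1) + 2 * K3) * (ctEnergy w + dtEnergy n) := by
    calc dtEnergy (S.received w n) ≤ 2 * dtEnergy (S.Ch.dtApply (S.transmitted w)) +
          2 * dtEnergy (S.Wn.dtApply n) := dtEnergy_add_le_two _ _
      _ ≤ 2 * (K2 * (K1 * ctEnergy w)) + 2 * (K3 * dtEnergy n) := by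
          gcongr
          · exact (h2 _).trans (mul_le_mul_right (h1 w hw) _)
          · exact h3 n
      _ = (2 * (K2 * K1)) * ctEnergy w + (2 * K3) * dtEnergy n := by ring
      _ ≤ (2 * (K2 * K1) + 2 * K3) * ctEnergy w + (2 * (K2 * K1) + 2 * K3) * dtEnergy n := by
          gcongr
          · exact le_self_add
          · exact le_add_self
      _ = _ := by ring
  rw [mul_assoc]
  exact (h4 _).trans (mul_le_mul_right ((dtEnergy_upsample_le S.M _).trans h5) _)

theorem Data.isL2_hold_filtered (hS : S.Admissible) {w : ℝ → ℝ} {n : ℕ → ℝ} (hw : IsL2 w)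
    (hn : dtEnergy n < ∞) : IsL2 (hold (S.h / S.M) (S.filtered w n)) := by
  obtain ⟨K, hK, h⟩ := Data.exists_filtered_le hS
  have := hw.ctEnergy_lt_top
  exact isL2_hold hS.period_pos ((h w n hw).trans_lt (by finiteness))

theorem Data.measurableOnIci_errR (hS : S.Admissible) {w : ℝ → ℝ} {n : ℕ → ℝ} (hw : IsL2 w)
    (hn : dtEnergy n < ∞) : MeasurableOnIci (S.errR w n) := by
  rw [funext (Data.errR_eq hS w n)]
  exact (((S.F.measurableOnIci_conv hw).delay S.L).sub
    (S.P.measurableOnIci_conv (Data.isL2_hold_filtered hS hw hn))).sub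
    ((measurable_hold _ _).measurableOnIci.const_mul _)

/-- The error system for receiver design is bounded. -/
theorem Data.exists_errR_le (hS : S.Admissible) :
    ∃ K : ℝ≥0∞, K < ∞ ∧ ∀ w n, IsL2 w → dtEnergy n < ∞ →
      ctEnergy (S.errR w n) ≤ K * (ctEnergy w + dtEnergy n) := by
  obtain ⟨K1, hK1, h1⟩ := hS.F_stable.exists_ctEnergy_conv_le
  obtain ⟨K2, hK2, h2⟩ := hS.P_stable.exists_ctEnergy_conv_le
  obtain ⟨K3, hK3, h3⟩ := Data.exists_filtered_le hS
  set c := ENNReal.ofReal (S.h / S.M)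
  set d := ‖S.P.D‖ₑ ^ 2
  have hd : d < ∞ := by simp [d]
  refine ⟨2 * (2 * K1 + 2 * (K2 * (c * K3))) + 2 * (d * (c * K3)), by finiteness,
    fun w n hw hn => ?_⟩
  have hv := Data.isL2_hold_filtered hS hw hn
  have m1 := (S.F.measurableOnIci_conv hw).delay S.L
  have m2 := S.P.measurableOnIci_conv hv
  set e := ctEnergy w + dtEnergy n
  have hw' : ctEnergy w ≤ e := le_self_add
  have hhold : ctEnergy (hold (S.h / S.M) (S.filtered w n)) ≤ c * (K3 * e) := by
    rw [ctEnergy_hold hS.period_pos]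
    exact mul_le_mul_right (h3 w n hw) _
  rw [funext (Data.errR_eq hS w n)]
  refine (ctEnergy_sub_le_two (m1.sub m2).aemeasurable).trans ?_
  rw [ctEnergy_const_mul]
  have h4 := ctEnergy_sub_le_two m1.aemeasurable
    (g := S.P.conv (hold (S.h / S.M) (S.filtered w n)))
  calc 2 * ctEnergy (fun t => delay S.L (S.F.conv w) t -
        S.P.conv (hold (S.h / S.M) (S.filtered w n)) t) +
        2 * (‖S.P.D‖ₑ ^ 2 * ctEnergy (hold (S.h / S.M) (S.filtered w n)))
      ≤ 2 * (2 * (K1 * e) + 2 * (K2 * (c * (K3 * e)))) + 2 * (d * (c * (K3 * e))) := by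
        gcongr
        refine h4.trans ?_
        gcongr
        · exact (ctEnergy_delay_le _ _).trans ((h1 w hw).trans (mul_le_mul_right hw' _))
        · exact (h2 _ hv).trans (mul_le_mul_right hhold _)
    _ = _ := by ring

/-- Linearity is used only to compare two inputs, so additivity is proved for differences. Finite
energy makes the convolution integrals converge. -/
theorem Data.transmitted_sub (hS : S.Admissible) {w v : ℝ → ℝ} (hw : IsL2 w) (hv : IsL2 v)
    (k : ℕ) :
    S.transmitted (fun t => w t - v t) k = S.transmitted w k - S.transmitted v k := by
  have h : sampler (S.h / S.M) (S.F.conv fun t => w t - v t) = fun j =>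
      sampler (S.h / S.M) (S.F.conv w) j - sampler (S.h / S.M) (S.F.conv v) j := by
    funext j
    have := hS.period_pos
    exact S.F.conv_sub hw hv (by positivity)
  simp only [Data.transmitted, hS.ctApply_F, h, downsample, SISO.dtApply_sub]

theorem Data.weightedT_sub (hS : S.Admissible) {w v : ℝ → ℝ} (hw : IsL2 w) (hv : IsL2 v)
    (k : ℕ) : S.weightedT (fun t => w t - v t) k = S.weightedT w k - S.weightedT v k := by
  rw [Data.weightedT, funext (Data.transmitted_sub hS hw hv), SISO.dtApply_sub]
  rfl

theorem Data.filtered_sub (hS : S.Admissible) {w v : ℝ → ℝ} (hw : IsL2 w) (hv : IsL2 v)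
    (n n' : ℕ → ℝ) (k : ℕ) : S.filtered (fun t => w t - v t) (fun j => n j - n' j) k =
      S.filtered w n k - S.filtered v n' k := by
  rw [Data.filtered, Data.filtered, Data.filtered, ← SISO.dtApply_sub]
  congr 1
  funext j
  simp only [upsample]
  split_ifs
  · simp only [Data.received, funext (Data.transmitted_sub hS hw hv), SISO.dtApply_sub]
    ring
  · ring

theorem Data.errR_sub (hS : S.Admissible) {w v : ℝ → ℝ} (hw : IsL2 w) (hv : IsL2 v)
    {n n' : ℕ → ℝ} (hn : dtEnergy n < ∞) (hn' : dtEnergy n' < ∞) {t : ℝ} (ht : 0 ≤ t) :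
    S.errR (fun t => w t - v t) (fun j => n j - n' j) t = S.errR w n t - S.errR v n' t := by
  have h1 : hold (S.h / S.M) (S.filtered (fun t => w t - v t) fun j => n j - n' j) = fun t =>
      hold (S.h / S.M) (S.filtered w n) t - hold (S.h / S.M) (S.filtered v n') t := by
    funext s
    rw [← hold_sub, funext (Data.filtered_sub hS hw hv n n')]
  have h2 : delay S.L (S.F.conv fun t => w t - v t) t =
      delay S.L (S.F.conv w) t - delay S.L (S.F.conv v) t := by
    simp only [delay]
    split_ifs with h
    · exact S.F.conv_sub hw hv (sub_nonneg.2 h)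
    · ring
  rw [Data.errR_eq hS, Data.errR_eq hS, Data.errR_eq hS, h1, h2,
    S.P.conv_sub (Data.isL2_hold_filtered hS hw hn) (Data.isL2_hold_filtered hS hv hn') ht]
  ring

/-- Fast sampling and hold of the output perturbs the error system for receiver design by an
operator of norm `O(1 / l)`. -/
theorem Data.exists_hold_sampler_errR_le (hS : S.Admissible) {m : ℕ} (hL : S.L = m * S.h) :
    ∃ K : ℝ, ∀ l : ℕ, 0 < l → ∀ w n, IsL2 w → dtEnergy n < ∞ →
      ctEnergy (fun t => hold (S.h / (S.M * l : ℕ)) (sampler (S.h / (S.M * l : ℕ))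
        (S.errR w n)) t - S.errR w n t) ≤
        ENNReal.ofReal (K * (S.h / (S.M * l : ℕ))) ^ 2 * (ctEnergy w + dtEnergy n) := by
  obtain ⟨K1, h1⟩ := hS.F_stable.exists_hold_sampler_conv_le S.h
  obtain ⟨K2, h2⟩ := hS.P_stable.exists_hold_sampler_conv_le S.h
  obtain ⟨K3, hK3, h3⟩ := Data.exists_filtered_le hS
  set c := ENNReal.ofReal (S.h / S.M) with hc
  have hcK : c * K3 < ∞ := by finiteness
  set b := (c * K3).toReal with hb
  -- The squared errors of the two branches add up with factors `2`; `b` bounds the energy of the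
  -- held receiver signal per unit of input energy.
  refine ⟨Real.sqrt (2 * |K1| ^ 2 + 2 * (|K2| ^ 2 * b)), fun l hl w n hw hn => ?_⟩
  set p := S.h / (S.M * l : ℕ) with hp
  have hM := hS.M_pos
  have hh := hS.h_pos
  have hMl : 0 < S.M * l := Nat.mul_pos hM hl
  have hp0 : 0 < p := div_pos hh (Nat.cast_pos.2 hMl)
  have hM' : (0 : ℝ) < S.M := Nat.cast_pos.2 hM
  have hl' : (0 : ℝ) < l := Nat.cast_pos.2 hl
  have hpl : S.h / S.M = l * p := by
    rw [hp]; push_cast; field_simp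
  have hpT : p ≤ S.h := div_le_self hh.le (by exact_mod_cast hMl)
  have hLp : S.L = ((m * (S.M * l) : ℕ) : ℝ) * p := by
    rw [hL, hp]; push_cast; field_simp
  have hv := Data.isL2_hold_filtered hS hw hn
  set v := S.filtered w n with hvdef
  set y := S.F.conv w
  set r := S.P.conv (hold (S.h / S.M) v)
  have my := S.F.measurableOnIci_conv hw
  -- The delay commutes with fast sampling and holding, and the feedthrough term is fixed by it and
  -- cancels. Only the sampling errors of `F` and of the strictly proper part of `P` remain.
  have key : ∀ t, 0 ≤ t → hold p (sampler p (S.errR w n)) t - S.errR w n t =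
      delay S.L (fun t => hold p (sampler p y) t - y t) t - (hold p (sampler p r) t - r t) := by
    intro t ht
    rw [funext (Data.errR_eq hS w n), hold_sampler_sub, hold_sampler_sub, sampler_const_mul,
      hold_const_mul, hLp, hold_sampler_delay hp0 _ _ ht, hpl, hold_sampler_hold hp0]
    have hr : r = S.P.conv (hold (l * p) (S.filtered w n)) := by simp only [r, hpl, v]
    simp only [delay, hr, y]
    split_ifs <;> ring
  rw [ctEnergy_congr key]
  have hmeas : MeasurableOnIci (delay S.L fun t => hold p (sampler p y) t - y t) :=
    ((measurable_hold _ _).measurableOnIci.sub my).delay _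
  refine (ctEnergy_sub_le_two hmeas.aemeasurable).trans ?_
  set e := ctEnergy w + dtEnergy n
  have hhold : ctEnergy (hold (S.h / S.M) v) ≤ c * (K3 * e) := by
    rw [ctEnergy_hold hS.period_pos]
    exact mul_le_mul_right (h3 w n hw) _
  have hsq : ∀ K : ℝ, ENNReal.ofReal (K * p) ^ 2 ≤ ENNReal.ofReal (|K| ^ 2 * p ^ 2) := fun K => by
    rw [← mul_pow, ENNReal.ofReal_pow (by positivity)]
    gcongr
    exact le_abs_self K
  calc 2 * ctEnergy (delay S.L fun t => hold p (sampler p y) t - y t) +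
        2 * ctEnergy (fun t => hold p (sampler p r) t - r t)
      ≤ 2 * (ENNReal.ofReal (|K1| ^ 2 * p ^ 2) * e) +
        2 * (ENNReal.ofReal (|K2| ^ 2 * p ^ 2) * (c * (K3 * e))) := by
        gcongr
        · refine (ctEnergy_delay_le _ _).trans ((h1 p hp0 hpT w hw).trans ?_)
          exact mul_le_mul' (hsq K1) le_self_add
        · exact (h2 p hp0 hpT _ hv).trans (mul_le_mul' (hsq K2) hhold)
    _ = (ENNReal.ofReal 2 * ENNReal.ofReal (|K1| ^ 2 * p ^ 2) +
        ENNReal.ofReal 2 * (ENNReal.ofReal (|K2| ^ 2 * p ^ 2) * ENNReal.ofReal b)) * e := by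
        rw [hb, ENNReal.ofReal_toReal hcK.ne, ENNReal.ofReal_ofNat]
        ring
    _ = _ := by
        have hb0 : 0 ≤ b := ENNReal.toReal_nonneg
        rw [← ENNReal.ofReal_mul (by positivity), ← ENNReal.ofReal_mul (by positivity),
          ← ENNReal.ofReal_mul (by positivity), ← ENNReal.ofReal_add (by positivity)
          (by positivity), ← ENNReal.ofReal_pow (by positivity), mul_pow,
          Real.sq_sqrt (by positivity)]
        congr 2
        ring

end ErrorSystem

/-! ### Realizing the discretizations -/

section FastDiscretization

variable {ι : Type} [Fintype ι] {S : Data}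

/-- On held inputs `F` acts at the fast rate through its step-invariant discretization, and the slow
samples are every `l`-th fast one. -/
theorem LiftRealizable.transmitted (hS : S.Admissible) {l : ℕ} (hl : 0 < l)
    {a : (ℕ → ι → ℝ) → ℕ → ℝ} (ha : LiftRealizable (S.M * l) a) :
    LiftRealizable 1 fun u => S.transmitted (hold (S.h / (S.M * l : ℕ)) (a u)) := by
  have hMl : 0 < S.M * l := Nat.mul_pos hS.M_pos hl
  have hp : 0 < S.h / (S.M * l : ℕ) := div_pos hS.h_pos (Nat.cast_pos.2 hMl)
  refine ((((ha.dtApply hMl (S.F.discretize (S.h / (S.M * l : ℕ)))).decimate hl).dtApply hS.M_pos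
    S.KT).downsample hS.M_pos).congr fun u => ?_
  rw [Data.transmitted, ← SISO.sampler_ctApply_hold _ hp]
  congr 2
  funext k
  have hl' : (l : ℝ) ≠ 0 := Nat.cast_ne_zero.2 hl.ne'
  simp only [sampler]
  congr 1
  push_cast
  field_simp

theorem LiftRealizable.weightedT (hS : S.Admissible) {l : ℕ} (hl : 0 < l)
    {a : (ℕ → ι → ℝ) → ℕ → ℝ} (ha : LiftRealizable (S.M * l) a) :
    LiftRealizable 1 fun u => S.weightedT (hold (S.h / (S.M * l : ℕ)) (a u)) :=
  (ha.transmitted hS hl).dtApply one_pos S.Wz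

/-- The fast-sampling/fast-hold discretization of the error system is realizable. -/
theorem LiftRealizable.errR (hS : S.Admissible) {m : ℕ} (hL : S.L = m * S.h) {l : ℕ} (hl : 0 < l)
    {a b : (ℕ → ι → ℝ) → ℕ → ℝ} (ha : LiftRealizable (S.M * l) a) (hb : LiftRealizable 1 b) :
    LiftRealizable (S.M * l) fun u => sampler (S.h / (S.M * l : ℕ))
      (S.errR (hold (S.h / (S.M * l : ℕ)) (a u)) (b u)) := by
  have hMl : 0 < S.M * l := Nat.mul_pos hS.M_pos hl
  have hp : 0 < S.h / (S.M * l : ℕ) := div_pos hS.h_pos (Nat.cast_pos.2 hMl)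
  have hM' : (S.M : ℝ) ≠ 0 := Nat.cast_ne_zero.2 hS.M_pos.ne'
  have hl' : (l : ℝ) ≠ 0 := Nat.cast_ne_zero.2 hl.ne'
  set p := S.h / (S.M * l : ℕ) with hpdef
  have hpl : S.h / S.M = l * p := by
    rw [hpdef]; push_cast; field_simp
  have hLp : S.L = ((m * (S.M * l) : ℕ) : ℝ) * p := by
    rw [hL, hpdef]; push_cast; field_simp
  have h1 := (ha.dtApply hMl (S.F.discretize p)).delay m
  have h2 : LiftRealizable 1 fun u => S.received (hold p (a u)) (b u) :=
    (((ha.transmitted hS hl).dtApply one_pos S.Ch).linear_comb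
      (hb.dtApply one_pos S.Wn) 1 1).congr fun u => by
        simp only [one_mul]
        rfl
  have h3 : LiftRealizable S.M fun u => S.filtered (hold p (a u)) (b u) :=
    (h2.upsample (M := S.M)).dtApply hS.M_pos S.KR
  -- A slow hold is the fast hold of the signal with each value repeated `l` times, so `P` too can
  -- be discretized at the fast rate.
  have h4 := (h3.repeat (l := l)).dtApply hMl (S.P.discretize p)
  refine (h1.linear_comb h4 1 (-1)).congr fun u => ?_
  funext k
  rw [← SISO.sampler_ctApply_hold _ hp, ← SISO.sampler_ctApply_hold _ hp, ← hold_mul_period,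
    ← sampler_delay hp, ← hpl, ← hLp, one_mul, neg_one_mul, ← sub_eq_add_neg]
  rfl

theorem liftRealizable_idlift {N : ℕ} (d : (ι → ℝ) →ₗ[ℝ] (Fin N → ℝ)) :
    LiftRealizable N fun u : ℕ → ι → ℝ => idlift N fun k => d (u k) :=
  (realizable_static d).congr fun _ => dlift_idlift _

theorem liftRealizable_one (d : (ι → ℝ) →ₗ[ℝ] ℝ) :
    LiftRealizable 1 fun (u : ℕ → ι → ℝ) k => d (u k) :=
  (realizable_static (LinearMap.pi fun _ : Fin 1 => d)).congr fun u => by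
    funext k i
    simp [dlift]

theorem Data.exists_isFSFHR (hS : S.Admissible) {m : ℕ} (hL : S.L = m * S.h) {l : ℕ}
    (hl : 0 < l) : ∃ T, S.IsFSFHR (S.M * l) T := by
  obtain ⟨T, hT⟩ := LiftRealizable.errR hS hL hl
    (liftRealizable_idlift (LinearMap.funLeft ℝ ℝ (Sum.inl : Fin (S.M * l) → _ ⊕ Unit)))
    (liftRealizable_one (LinearMap.proj (Sum.inr () : Fin (S.M * l) ⊕ Unit)))
  exact ⟨T, fun w n => hT fun k => Sum.elim (w k) fun _ => n k⟩

theorem Data.exists_isFSFHT (hS : S.Admissible) {m : ℕ} (hL : S.L = m * S.h) {l : ℕ}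
    (hl : 0 < l) : ∃ T, S.IsFSFHT (S.M * l) T := by
  have ha : LiftRealizable (S.M * l) fun u : ℕ → Fin (S.M * l) → ℝ => idlift (S.M * l) u :=
    liftRealizable_idlift LinearMap.id
  have h0 : LiftRealizable 1 fun (_ : ℕ → Fin (S.M * l) → ℝ) (_ : ℕ) => (0 : ℝ) :=
    (liftRealizable_one 0).congr fun _ => by simp
  have he := LiftRealizable.errR hS hL hl ha h0
  have hz := (realizable_static (LinearMap.funLeft ℝ ℝ fun _ : Unit => (0 : Fin 1))).comp
    (LiftRealizable.weightedT hS hl ha)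
  obtain ⟨T, hT⟩ := Realizable.sumElim he hz
  refine ⟨T, fun w => ?_⟩
  rw [hT, Data.errT_eq_errR]
  funext k i
  rcases i with i | i
  · simp only [Sum.elim_inl]
  · simp only [Sum.elim_inr, LinearMap.funLeft_apply, dlift, mul_one, Fin.val_zero, add_zero]

end FastDiscretization

/-! ### An abstract convergence theorem for gains -/

section Gain

/-- The supremum of the quotient `num / den` over the elements of `A` with `den ≠ 0`. -/
def gain {I : Type*} (A : Set I) (num den : I → ℝ≥0∞) : ℝ≥0∞ :=
  ⨆ (i : I) (_ : i ∈ A) (_ : den i ≠ 0), num i / den i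

theorem gain_le {I : Type*} {A : Set I} {num den : I → ℝ≥0∞} {K : ℝ≥0∞}
    (h : ∀ i ∈ A, num i ≤ K * den i) : gain A num den ≤ K :=
  iSup_le fun i => iSup_le fun hi => iSup_le fun _ => ENNReal.div_le_of_le_mul (h i hi)

theorem le_gain_mul {I : Type*} {A : Set I} {num den : I → ℝ≥0∞} {i : I} (hi : i ∈ A)
    (h0 : den i = 0 → num i = 0) (hfin : den i ≠ ∞) : num i ≤ gain A num den * den i := by
  by_cases hd : den i = 0
  · rw [h0 hd]
    exact zero_le
  · rw [← ENNReal.div_le_iff hd hfin]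
    exact le_iSup_of_le i (le_iSup_of_le hi (le_iSup_of_le hd le_rfl))

theorem tendsto_ofReal_one_add : Tendsto (fun η : ℝ => ENNReal.ofReal (1 + η)) (𝓝[>] 0) (𝓝 1) := by
  have : Continuous fun η : ℝ => ENNReal.ofReal (1 + η) :=
    ENNReal.continuous_ofReal.comp (continuous_const.add continuous_id)
  have h := this.tendsto 0
  simp only [add_zero, ENNReal.ofReal_one] at h
  exact h.mono_left nhdsWithin_le_nhds

theorem tendsto_ofReal_zero : Tendsto (fun η : ℝ => ENNReal.ofReal η) (𝓝[>] 0) (𝓝 0) := by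
  have h := ENNReal.continuous_ofReal.tendsto 0
  rw [ENNReal.ofReal_zero] at h
  exact h.mono_left nhdsWithin_le_nhds

/-- Convergence of the gains of approximations whose outputs are uniformly close and whose input
sets are asymptotically dense. -/
theorem tendsto_gain {I : Type*} {A : Set I} {B : ℕ → Set I} {num den : I → ℝ≥0∞}
    {numB : ℕ → I → ℝ≥0∞} {K : ℝ≥0∞} {ε : ℕ → ℝ≥0∞} (hK : K < ∞) (hden : ∀ i ∈ A, den i < ∞)
    (hBA : ∀ l, 0 < l → B l ⊆ A) (hbound : ∀ i ∈ A, num i ≤ K * den i)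
    (hε : Tendsto ε atTop (𝓝 0))
    (hupper : ∀ l, 0 < l → ∀ η : ℝ, 0 < η → ∀ i ∈ B l, numB l i ≤
      ENNReal.ofReal (1 + η) * num i + ENNReal.ofReal (1 + η⁻¹) * (ε l * den i))
    (hlower : ∀ i ∈ A, ∀ η : ℝ, 0 < η → ∀ᶠ l in atTop, ∃ j ∈ B l,
      num i ≤ ENNReal.ofReal (1 + η) * numB l j + ENNReal.ofReal η ∧
      den j ≤ ENNReal.ofReal (1 + η) * den i + ENNReal.ofReal η) :
    Tendsto (fun l => gain (B l) (numB l) den) atTop (𝓝 (gain A num den)) := by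
  have hR : gain A num den < ∞ := (gain_le hbound).trans_lt hK
  set R := gain A num den with hRdef
  have hzero : ∀ i ∈ A, den i = 0 → num i = 0 := fun i hi h => by
    have := hbound i hi
    rwa [h, mul_zero, nonpos_iff_eq_zero] at this
  rw [tendsto_order]
  constructor
  · intro a ha
    obtain ⟨i, hi⟩ := lt_iSup_iff.1 ha
    obtain ⟨hiA, hi⟩ := lt_iSup_iff.1 hi
    obtain ⟨hi0, hi⟩ := lt_iSup_iff.1 hi
    have hax : a * den i < num i := (ENNReal.lt_div_iff_mul_lt (Or.inl hi0)
      (Or.inl (hden i hiA).ne)).1 hi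
    have ha' : a ≠ ∞ := (ha.trans hR).ne
    -- If the approximate gain were at most `a`, the two inequalities of `hlower` would bound `num
    -- i` by this expression. At `η = 0` it equals `a * den i < num i`, so a small `η` gives a
    -- contradiction.
    have hlim : Tendsto (fun η : ℝ => ENNReal.ofReal (1 + η) *
        (a * (ENNReal.ofReal (1 + η) * den i + ENNReal.ofReal η)) + ENNReal.ofReal η) (𝓝[>] 0)
        (𝓝 (1 * (a * (1 * den i + 0)) + 0)) := by
      refine Tendsto.add (ENNReal.Tendsto.mul tendsto_ofReal_one_add (Or.inl one_ne_zero)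
        (ENNReal.Tendsto.const_mul (Tendsto.add (ENNReal.Tendsto.mul_const tendsto_ofReal_one_add
          (Or.inl one_ne_zero)) tendsto_ofReal_zero) (Or.inr ha')) (Or.inr ENNReal.one_ne_top))
        tendsto_ofReal_zero
    simp only [one_mul, add_zero] at hlim
    obtain ⟨η, hη, hη0⟩ := ((hlim.eventually (gt_mem_nhds hax)).and self_mem_nhdsWithin).exists
    filter_upwards [hlower i hiA η hη0, eventually_gt_atTop 0] with l ⟨j, hjB, h1, h2⟩ hl
    have hjA := hBA l hl hjB
    by_contra hcon
    rw [not_lt] at hcon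
    have h3 : numB l j ≤ gain (B l) (numB l) den * den j := by
      refine le_gain_mul hjB (fun h => ?_) (hden j hjA).ne
      have := hupper l hl 1 one_pos j hjB
      rwa [hzero j hjA h, h, mul_zero, mul_zero, mul_zero, add_zero, nonpos_iff_eq_zero] at this
    refine absurd hη (not_lt.2 (h1.trans ?_))
    gcongr
    exact h3.trans (mul_le_mul' hcon h2)
  · intro b hb
    have hlim : Tendsto (fun η : ℝ => ENNReal.ofReal (1 + η) * R) (𝓝[>] 0) (𝓝 (1 * R)) :=
      ENNReal.Tendsto.mul_const tendsto_ofReal_one_add (Or.inr hR.ne)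
    rw [one_mul] at hlim
    -- The order of choices matters: `η` is fixed first, and then `l` is taken large enough for `ε
    -- l` to beat `1 + η⁻¹`.
    obtain ⟨η, hη, hη0⟩ := ((hlim.eventually (gt_mem_nhds hb)).and self_mem_nhdsWithin).exists
    have hlim2 : Tendsto (fun l => ENNReal.ofReal (1 + η) * R + ENNReal.ofReal (1 + η⁻¹) * ε l)
        atTop (𝓝 (ENNReal.ofReal (1 + η) * R + ENNReal.ofReal (1 + η⁻¹) * 0)) :=
      tendsto_const_nhds.add (ENNReal.Tendsto.const_mul hε (Or.inr ENNReal.ofReal_ne_top))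
    rw [mul_zero, add_zero] at hlim2
    filter_upwards [hlim2.eventually (gt_mem_nhds hη), eventually_gt_atTop 0] with l hl hl0
    refine (gain_le fun i hi => ?_).trans_lt hl
    have hiA := hBA l hl0 hi
    refine (hupper l hl0 η hη0 i hi).trans ?_
    rw [add_mul, mul_assoc, mul_assoc]
    gcongr
    exact le_gain_mul hiA (hzero i hiA) (hden i hiA).ne

end Gain

/-! ### Density of held signals in `L²` -/

section Density

/-- Piecewise constant functions on fine grids approximate `L²` functions. -/
theorem IsL2.eventually_exists_hold {w : ℝ → ℝ} (hw : IsL2 w) {p : ℕ → ℝ}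
    (hp : ∀ᶠ l in atTop, 0 < p l) (hp0 : Tendsto p atTop (𝓝 0)) {d : ℝ} (hd : 0 < d) :
    ∀ᶠ l in atTop, ∃ v : ℕ → ℝ, dtEnergy v < ∞ ∧
      ctEnergy (fun t => w t - hold (p l) v t) ≤ ENNReal.ofReal d := by
  have hw0 : MemLp ((Set.Ici (0 : ℝ)).indicator w) 2 volume :=
    (memLp_indicator_iff_restrict measurableSet_Ici).2 hw
  -- Error budget: `d / 4` in energy for passing to a continuous compactly supported `g`, and `d /
  -- 4` for holding the samples of `g`. Adding two errors doubles each energy.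
  have hε : ENNReal.ofReal (Real.sqrt d / 2) ≠ 0 := by
    have : 0 < Real.sqrt d / 2 := by positivity
    simpa using this
  obtain ⟨g, hgs, hgd, hgc, hgm⟩ :=
    hw0.exists_hasCompactSupport_eLpNorm_sub_le ENNReal.ofNat_ne_top hε
  have hg2 : IsL2 g := hgm.restrict _
  have hwg : ctEnergy (fun t => w t - g t) ≤ ENNReal.ofReal (d / 4) := by
    have h1 : ctEnergy (fun t => w t - g t) ≤ ∫⁻ t, ‖((Set.Ici (0 : ℝ)).indicator w - g) t‖ₑ ^ 2 := by
      refine le_trans (le_of_eq (setLIntegral_congr_fun measurableSet_Ici fun t ht => ?_))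
        (setLIntegral_le_lintegral (Set.Ici 0) _)
      simp only [Pi.sub_apply, Set.indicator_of_mem ht]
    have h2 : ∫⁻ t, ‖((Set.Ici (0 : ℝ)).indicator w - g) t‖ₑ ^ 2 =
        eLpNorm ((Set.Ici (0 : ℝ)).indicator w - g) 2 volume ^ 2 := by
      rw [eLpNorm_eq_lintegral_rpow_enorm_toReal (by simp) (by simp), ← ENNReal.rpow_natCast,
        ← ENNReal.rpow_mul]
      simp
    rw [h2] at h1
    refine h1.trans ((pow_le_pow_left' hgd 2).trans (le_of_eq ?_))
    rw [← ENNReal.ofReal_pow (by positivity), div_pow, Real.sq_sqrt hd.le]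
    norm_num
  obtain ⟨R, hR0, hR⟩ : ∃ R : ℝ, 0 < R ∧ ∀ t, R < t → g t = 0 := by
    obtain ⟨R, hR⟩ := hgs.isCompact.isBounded.subset_closedBall 0
    refine ⟨max R 1, by positivity, fun t ht => image_eq_zero_of_notMem_tsupport fun hmem => ?_⟩
    have := hR hmem
    rw [mem_closedBall_zero_iff, Real.norm_eq_abs] at this
    linarith [le_abs_self t, le_max_left R 1]
  have huc : UniformContinuous g := hgs.uniformContinuous_of_continuous hgc
  -- Chosen so that an error of size `ω` on `[0, R + 1]` has energy `d / 4`.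
  set ω := Real.sqrt (d / (4 * (R + 1))) with hω
  have hω0 : 0 < ω := by positivity
  obtain ⟨δ, hδ0, hδ⟩ := Metric.uniformContinuous_iff.1 huc ω hω0
  filter_upwards [hp, hp0.eventually (gt_mem_nhds hδ0), hp0.eventually (gt_mem_nhds one_pos)]
    with l hl1 hl2 hl3
  set q := p l
  have hpt : ∀ t, 0 ≤ t → ‖g t - hold q (sampler q g) t‖ₑ ^ 2 ≤
      (Set.Icc 0 (R + 1)).indicator (fun _ => ENNReal.ofReal (ω ^ 2)) t := by
    intro t ht
    have hk1 : (⌊t / q⌋₊ : ℝ) * q ≤ t := (le_div_iff₀ hl1).1 (Nat.floor_le (by positivity))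
    have hk2 : t < (⌊t / q⌋₊ + 1) * q := (div_lt_iff₀ hl1).1 (Nat.lt_floor_add_one _)
    rw [hold_apply_of_nonneg _ _ ht, sampler]
    by_cases htR : t ≤ R + 1
    · have hmem : t ∈ Set.Icc 0 (R + 1) := ⟨ht, htR⟩
      rw [Set.indicator_of_mem hmem, ENNReal.ofReal_pow hω0.le]
      gcongr
      refine enorm_le_ofReal_of_abs_le ?_
      have := hδ (a := t) (b := ⌊t / q⌋₊ * q) (by
        rw [Real.dist_eq, abs_of_nonneg (by linarith)]
        linarith)
      rw [Real.dist_eq] at this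
      exact this.le
    -- The period is below `1`, so for `t > R + 1` the preceding sampling instant also lies beyond
    -- `R`, and both values vanish.
    · rw [hR t (by linarith), hR _ (by linarith)]
      simp
  have hgh : ctEnergy (fun t => g t - hold q (sampler q g) t) ≤ ENNReal.ofReal (d / 4) := by
    calc ctEnergy (fun t => g t - hold q (sampler q g) t)
        ≤ ∫⁻ t in Set.Ici (0 : ℝ),
          (Set.Icc 0 (R + 1)).indicator (fun _ => ENNReal.ofReal (ω ^ 2)) t := by
          refine lintegral_mono_ae ?_
          filter_upwards [ae_restrict_mem measurableSet_Ici] with t ht using hpt t ht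
      _ ≤ ∫⁻ t, (Set.Icc 0 (R + 1)).indicator (fun _ => ENNReal.ofReal (ω ^ 2)) t :=
          setLIntegral_le_lintegral _ _
      _ = ENNReal.ofReal (d / 4) := by
          rw [lintegral_indicator measurableSet_Icc, setLIntegral_const, Real.volume_Icc,
            ← ENNReal.ofReal_mul (by positivity), hω, Real.sq_sqrt (by positivity)]
          congr 1
          field_simp
          ring
  refine ⟨sampler q g, ?_, ?_⟩
  · have h1 : ctEnergy (hold q (sampler q g)) < ∞ := by
      have h2 := ctEnergy_sub_le_two (g := fun t => g t - hold q (sampler q g) t) hg2.1.aemeasurable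
      simp only [sub_sub_cancel] at h2
      have h3 := hg2.ctEnergy_lt_top
      have h4 := hgh.trans_lt ENNReal.ofReal_lt_top
      exact h2.trans_lt (by finiteness)
    rw [ctEnergy_hold hl1] at h1
    exact lt_of_not_ge fun h => by
      rw [top_le_iff.1 h, ENNReal.mul_top (by simpa using hl1)] at h1
      exact lt_irrefl _ h1
  · have h1 := ctEnergy_add_le_two (f := fun t => w t - g t)
      (g := fun t => g t - hold q (sampler q g) t) (hw.sub hg2).1.aemeasurable
    simp only [sub_add_sub_cancel] at h1
    calc _ ≤ 2 * ENNReal.ofReal (d / 4) + 2 * ENNReal.ofReal (d / 4) := by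
          refine h1.trans ?_
          gcongr
      _ = ENNReal.ofReal d := by
          rw [← ENNReal.ofReal_ofNat, ← ENNReal.ofReal_mul (by norm_num),
            ← ENNReal.ofReal_add (by positivity) (by positivity)]
          congr 1
          ring

end Density

/-! ### Convergence of the sampled gains -/

section Convergence

variable {S : Data}

/-- The input energy. -/
def inputEnergy (i : (ℝ → ℝ) × (ℕ → ℝ)) : ℝ≥0∞ := ctEnergy i.1 + dtEnergy i.2

/-- Finite-energy inputs whose second component lies in `D`. -/
def inputs (D : Set (ℕ → ℝ)) : Set ((ℝ → ℝ) × (ℕ → ℝ)) :=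
  {i | IsL2 i.1 ∧ dtEnergy i.2 < ∞ ∧ i.2 ∈ D}

/-- Finite-energy inputs whose first component is held with period `p`, and whose second component
lies in `D`. -/
def heldInputs (D : Set (ℕ → ℝ)) (p : ℝ) : Set ((ℝ → ℝ) × (ℕ → ℝ)) :=
  {i | (∃ v, dtEnergy v < ∞ ∧ i.1 = hold p v) ∧ dtEnergy i.2 < ∞ ∧ i.2 ∈ D}

theorem heldInputs_subset (D : Set (ℕ → ℝ)) {p : ℝ} (hp : 0 < p) : heldInputs D p ⊆ inputs D := by
  rintro ⟨w, n⟩ ⟨⟨v, hv, rfl⟩, hn⟩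
  exact ⟨isL2_hold hp hv, hn⟩

/-- The energy of the output `e_c`, plus `κ` times the energy of the output `z_d`. -/
def Data.outputEnergy (S : Data) (κ : ℝ≥0∞) (i : (ℝ → ℝ) × (ℕ → ℝ)) : ℝ≥0∞ :=
  ctEnergy (S.errR i.1 i.2) + κ * dtEnergy (S.weightedT i.1)

/-- The output energy with `e_c` replaced by the hold of its samples with period `p`. -/
def Data.sampledEnergy (S : Data) (κ : ℝ≥0∞) (p : ℝ) (i : (ℝ → ℝ) × (ℕ → ℝ)) : ℝ≥0∞ :=
  ctEnergy (hold p (sampler p (S.errR i.1 i.2))) + κ * dtEnergy (S.weightedT i.1)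

theorem inputEnergy_lt_top {D : Set (ℕ → ℝ)} {i : (ℝ → ℝ) × (ℕ → ℝ)} (hi : i ∈ inputs D) :
    inputEnergy i < ∞ := by
  have h1 := hi.1.ctEnergy_lt_top
  have h2 := hi.2.1
  exact ENNReal.add_lt_top.2 ⟨h1, h2⟩

theorem Data.exists_outputEnergy_le (hS : S.Admissible) {κ : ℝ≥0∞} (hκ : κ < ∞) :
    ∃ K : ℝ≥0∞, K < ∞ ∧ ∀ D, ∀ i ∈ inputs D, S.outputEnergy κ i ≤ K * inputEnergy i := by
  obtain ⟨K1, hK1, h1⟩ := Data.exists_errR_le hS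
  obtain ⟨K2, hK2, h2⟩ := Data.exists_weightedT_le hS
  refine ⟨K1 + κ * K2, by finiteness, fun D i hi => ?_⟩
  rw [add_mul, mul_assoc]
  refine add_le_add (h1 _ _ hi.1 hi.2.1) (mul_le_mul_right ((h2 _ hi.1).trans ?_) _)
  exact mul_le_mul_right le_self_add _

theorem one_le_ofReal_one_add {η : ℝ} (hη : 0 < η) : 1 ≤ ENNReal.ofReal (1 + η) :=
  ENNReal.one_le_ofReal.2 (by linarith)

theorem Data.exists_sampledEnergy_le (hS : S.Admissible) {m : ℕ} (hL : S.L = m * S.h) (κ : ℝ≥0∞) :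
    ∃ K : ℝ, ∀ l : ℕ, 0 < l → ∀ η : ℝ, 0 < η → ∀ D, ∀ i ∈ inputs D,
      S.sampledEnergy κ (S.h / (S.M * l : ℕ)) i ≤ ENNReal.ofReal (1 + η) * S.outputEnergy κ i +
        ENNReal.ofReal (1 + η⁻¹) *
          (ENNReal.ofReal (K * (S.h / (S.M * l : ℕ))) ^ 2 * inputEnergy i) := by
  obtain ⟨K, hK⟩ := Data.exists_hold_sampler_errR_le hS hL
  refine ⟨K, fun l hl η hη D i hi => ?_⟩
  set p := S.h / (S.M * l : ℕ)
  have h1 := ctEnergy_add_le (f := S.errR i.1 i.2)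
    (g := fun t => hold p (sampler p (S.errR i.1 i.2)) t - S.errR i.1 i.2 t)
    (Data.measurableOnIci_errR hS hi.1 hi.2.1).aemeasurable hη
  simp only [add_sub_cancel] at h1
  have h2 := hK l hl i.1 i.2 hi.1 hi.2.1
  calc S.sampledEnergy κ p i
      ≤ (ENNReal.ofReal (1 + η) * ctEnergy (S.errR i.1 i.2) + ENNReal.ofReal (1 + η⁻¹) *
          (ENNReal.ofReal (K * p) ^ 2 * inputEnergy i)) +
          ENNReal.ofReal (1 + η) * (κ * dtEnergy (S.weightedT i.1)) := by
        refine add_le_add (h1.trans ?_) (le_mul_of_one_le_left' (one_le_ofReal_one_add hη))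
        gcongr
        exact h2
    _ = _ := by
        rw [Data.outputEnergy]
        ring

theorem exists_pos_mul_ofReal_le {C : ℝ≥0∞} (hC : C < ∞) {η : ℝ} (hη : 0 < η) :
    ∃ d : ℝ, 0 < d ∧ C * ENNReal.ofReal d ≤ ENNReal.ofReal η := by
  have hC0 : 0 ≤ C.toReal := ENNReal.toReal_nonneg
  refine ⟨η / (C.toReal + 1), by positivity, ?_⟩
  have hle : C.toReal * (η / (C.toReal + 1)) ≤ η := by
    rw [mul_div_assoc', div_le_iff₀ (by positivity)]
    nlinarith
  calc C * ENNReal.ofReal (η / (C.toReal + 1))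
      = ENNReal.ofReal (C.toReal * (η / (C.toReal + 1))) := by
        rw [ENNReal.ofReal_mul hC0, ENNReal.ofReal_toReal hC.ne]
    _ ≤ _ := ENNReal.ofReal_le_ofReal hle

theorem Data.tendsto_period (S : Data) (hS : S.Admissible) :
    Tendsto (fun l : ℕ => S.h / (S.M * l : ℕ)) atTop (𝓝 0) := by
  refine tendsto_const_nhds.div_atTop (tendsto_natCast_atTop_atTop.comp ?_)
  exact tendsto_id.const_mul_atTop' hS.M_pos

theorem Data.Admissible.fast_period_pos (hS : S.Admissible) {l : ℕ} (hl : 0 < l) : 0 < S.h / (S.M * l : ℕ) :=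
  div_pos hS.h_pos (Nat.cast_pos.2 (Nat.mul_pos hS.M_pos hl))

theorem Data.tendsto_errorBound (hS : S.Admissible) (K : ℝ) :
    Tendsto (fun l : ℕ => ENNReal.ofReal (K * (S.h / (S.M * l : ℕ))) ^ 2) atTop (𝓝 0) := by
  have h1 := (ENNReal.continuous_ofReal.tendsto _).comp ((S.tendsto_period hS).const_mul K)
  have h2 := ((ENNReal.continuous_pow 2).tendsto _).comp h1
  simpa [Function.comp_def] using h2

/-- Every finite-energy input is approximated by held inputs whose sampled output energy is
asymptotically not smaller. -/
theorem Data.eventually_exists_held (hS : S.Admissible) {m : ℕ} (hL : S.L = m * S.h)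
    {κ : ℝ≥0∞} (hκ : κ < ∞) (D : Set (ℕ → ℝ)) {i : (ℝ → ℝ) × (ℕ → ℝ)} (hi : i ∈ inputs D)
    {η : ℝ} (hη : 0 < η) :
    ∀ᶠ l : ℕ in atTop, ∃ j ∈ heldInputs D (S.h / (S.M * l : ℕ)),
      S.outputEnergy κ i ≤ ENNReal.ofReal (1 + η) * S.sampledEnergy κ (S.h / (S.M * l : ℕ)) j +
        ENNReal.ofReal η ∧
      inputEnergy j ≤ ENNReal.ofReal (1 + η) * inputEnergy i + ENNReal.ofReal η := by
  obtain ⟨w, n⟩ := i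
  obtain ⟨hw, hn, hnD⟩ := hi
  obtain ⟨K1, hK1, h1⟩ := Data.exists_errR_le hS
  obtain ⟨K2, hK2, h2⟩ := Data.exists_weightedT_le hS
  obtain ⟨K, hK⟩ := Data.exists_hold_sampler_errR_le hS hL
  have hin : inputEnergy (w, n) < ∞ := inputEnergy_lt_top (D := D) ⟨hw, hn, hnD⟩
  set a := ENNReal.ofReal (1 + η) with ha
  set c := ENNReal.ofReal (1 + η⁻¹) with hc
  have haf : a < ∞ := ENNReal.ofReal_lt_top
  have hcf : c < ∞ := ENNReal.ofReal_lt_top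
  -- The constant collects every contribution of the input error `d` to the output, and these may
  -- use half of `η`. The summand `1` makes `c * d` small as well, as needed for the input energy.
  -- The other half of `η` is kept for the sampling error.
  obtain ⟨d, hd, hCd⟩ := exists_pos_mul_ofReal_le (C := c * (2 * K1 + κ * K2 + 1))
    (by finiteness) (half_pos hη)
  -- A bound for the energy of the approximating inputs that does not depend on `l`; hence the
  -- sampling error tends to zero although these inputs vary.
  set X := a * inputEnergy (w, n) + ENNReal.ofReal η with hX
  have hXf : X < ∞ := by finiteness
  have hlim : Tendsto (fun l : ℕ => c * (2 * X) * ENNReal.ofReal (K * (S.h / (S.M * l : ℕ))) ^ 2)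
      atTop (𝓝 (c * (2 * X) * 0)) :=
    ENNReal.Tendsto.const_mul (Data.tendsto_errorBound hS K) (Or.inr (by finiteness))
  rw [mul_zero] at hlim
  have hη2 : (0 : ℝ≥0∞) < ENNReal.ofReal (η / 2) := ENNReal.ofReal_pos.2 (half_pos hη)
  filter_upwards [hw.eventually_exists_hold (p := fun l : ℕ => S.h / (S.M * l : ℕ))
    ((eventually_gt_atTop 0).mono fun l hl => Data.Admissible.fast_period_pos hS hl) (S.tendsto_period hS) hd,
    hlim.eventually (gt_mem_nhds hη2), eventually_gt_atTop 0] with l ⟨v, hv, hwv⟩ hl1 hl0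
  set p := S.h / (S.M * l : ℕ) with hp
  set e := ENNReal.ofReal (K * p) ^ 2 with he
  have hp0 : 0 < p := Data.Admissible.fast_period_pos hS hl0
  have hw' : IsL2 (hold p v) := isL2_hold hp0 hv
  set w' := hold p v with hw'def
  set x := ENNReal.ofReal d with hx
  have hfine : c * x ≤ ENNReal.ofReal η := by
    have h3 : c * x ≤ c * (2 * K1 + κ * K2 + 1) * x := by
      gcongr
      exact le_mul_of_one_le_right' le_add_self
    exact h3.trans (hCd.trans (ENNReal.ofReal_le_ofReal (by linarith)))
  have hinput : inputEnergy (w', n) ≤ X := by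
    have h3 := ctEnergy_add_le (f := w) (g := fun t => -(w t - w' t)) hw.1.aemeasurable hη
    rw [ctEnergy_neg] at h3
    simp only [← sub_eq_add_neg, sub_sub_cancel] at h3
    calc inputEnergy (w', n) ≤ (a * ctEnergy w + c * x) + a * dtEnergy n := by
          refine add_le_add (h3.trans ?_) (le_mul_of_one_le_left' (one_le_ofReal_one_add hη))
          gcongr
      _ ≤ (a * ctEnergy w + ENNReal.ofReal η) + a * dtEnergy n := by gcongr
      _ = X := by rw [hX, inputEnergy]; ring
  refine ⟨(w', n), ⟨⟨v, hv, rfl⟩, hn, hnD⟩, ?_, hinput⟩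
  have hz : dtEnergy (S.weightedT w) ≤ a * dtEnergy (S.weightedT w') + c * (K2 * x) := by
    have h3 := dtEnergy_add_le (S.weightedT w') (S.weightedT fun t => w t - w' t) hη
    simp only [Data.weightedT_sub hS hw hw', add_sub_cancel] at h3
    refine h3.trans ?_
    gcongr
    exact (h2 _ (hw.sub hw')).trans (mul_le_mul_right hwv _)
  have hme := Data.measurableOnIci_errR hS hw hn
  have hme' := Data.measurableOnIci_errR hS hw' hn
  have hmh := (measurable_hold p (sampler p (S.errR w' n))).measurableOnIci
  have hdiff : ctEnergy (fun t => S.errR w n t - S.errR w' n t) ≤ K1 * x := by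
    -- The noise is left unchanged, so the difference of the two inputs has no noise and the
    -- approximating input stays in `D`.
    have h3 := h1 (fun t => w t - w' t) (fun j => n j - n j) (hw.sub hw') (by simp [dtEnergy])
    rw [ctEnergy_congr fun t ht => Data.errR_sub hS hw hw' hn hn ht] at h3
    refine h3.trans ?_
    gcongr
    simpa [dtEnergy] using hwv
  have hg : ctEnergy (fun t => S.errR w n t - hold p (sampler p (S.errR w' n)) t) ≤
      2 * (K1 * x) + 2 * (e * X) := by
    have h3 := ctEnergy_sub_le_two (f := fun t => S.errR w n t - S.errR w' n t)
      (g := fun t => hold p (sampler p (S.errR w' n)) t - S.errR w' n t)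
      (hme.sub hme').aemeasurable
    simp only [sub_sub_sub_cancel_right] at h3
    refine h3.trans ?_
    gcongr
    exact (hK l hl0 w' n hw' hn).trans (mul_le_mul_right hinput _)
  have herr : ctEnergy (S.errR w n) ≤
      a * ctEnergy (hold p (sampler p (S.errR w' n))) + c * (2 * (K1 * x) + 2 * (e * X)) := by
    have h3 := ctEnergy_add_le (f := hold p (sampler p (S.errR w' n)))
      (g := fun t => S.errR w n t - hold p (sampler p (S.errR w' n)) t) hmh.aemeasurable hη
    simp only [add_sub_cancel] at h3
    refine h3.trans ?_
    gcongr
  calc S.outputEnergy κ (w, n)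
      ≤ (a * ctEnergy (hold p (sampler p (S.errR w' n))) + c * (2 * (K1 * x) + 2 * (e * X))) +
        κ * (a * dtEnergy (S.weightedT w') + c * (K2 * x)) :=
        add_le_add herr (mul_le_mul_right hz _)
    _ = a * S.sampledEnergy κ p (w', n) + (c * (2 * K1 + κ * K2) * x + c * (2 * X) * e) := by
        rw [Data.sampledEnergy]
        ring
    _ ≤ a * S.sampledEnergy κ p (w', n) + (ENNReal.ofReal (η / 2) + ENNReal.ofReal (η / 2)) := by
        gcongr
        exact le_trans (mul_le_mul_left (mul_le_mul_right le_self_add c) x) hCd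
    _ = _ := by
        rw [← ENNReal.ofReal_add (by positivity) (by positivity), add_halves]

theorem Data.tendsto_sampled_gain (hS : S.Admissible) {m : ℕ} (hL : S.L = m * S.h)
    {κ : ℝ≥0∞} (hκ : κ < ∞) (D : Set (ℕ → ℝ)) :
    Tendsto (fun l : ℕ => gain (heldInputs D (S.h / (S.M * l : ℕ)))
      (S.sampledEnergy κ (S.h / (S.M * l : ℕ))) inputEnergy) atTop
      (𝓝 (gain (inputs D) (S.outputEnergy κ) inputEnergy)) := by
  obtain ⟨K1, hK1, h1⟩ := Data.exists_outputEnergy_le hS hκ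
  obtain ⟨K2, h2⟩ := Data.exists_sampledEnergy_le hS hL κ
  have hsub : ∀ l : ℕ, 0 < l → heldInputs D (S.h / (S.M * l : ℕ)) ⊆ inputs D := fun l hl =>
    heldInputs_subset D (Data.Admissible.fast_period_pos hS hl)
  exact tendsto_gain (B := fun l : ℕ => heldInputs D (S.h / (S.M * l : ℕ)))
    (numB := fun l : ℕ => S.sampledEnergy κ (S.h / (S.M * l : ℕ))) hK1
    (fun i hi => inputEnergy_lt_top hi) hsub (h1 D) (Data.tendsto_errorBound hS K2)
    (fun l hl η hη i hi => h2 l hl η hη D i (hsub l hl hi))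
    (fun i hi η hη => Data.eventually_exists_held hS hL hκ D hi hη)

theorem Data.gain_outputEnergy_lt_top (hS : S.Admissible) {κ : ℝ≥0∞} (hκ : κ < ∞)
    (D : Set (ℕ → ℝ)) : gain (inputs D) (S.outputEnergy κ) inputEnergy < ∞ := by
  obtain ⟨K, hK, h⟩ := Data.exists_outputEnergy_le hS hκ
  exact (gain_le (h D)).trans_lt hK

theorem Data.gain_sampledEnergy_lt_top (hS : S.Admissible) {m : ℕ} (hL : S.L = m * S.h)
    {κ : ℝ≥0∞} (hκ : κ < ∞) (D : Set (ℕ → ℝ)) {l : ℕ} (hl : 0 < l) :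
    gain (heldInputs D (S.h / (S.M * l : ℕ))) (S.sampledEnergy κ (S.h / (S.M * l : ℕ)))
      inputEnergy < ∞ := by
  obtain ⟨K1, hK1, h1⟩ := Data.exists_outputEnergy_le hS hκ
  obtain ⟨K2, h2⟩ := Data.exists_sampledEnergy_le hS hL κ
  refine (gain_le (K := ENNReal.ofReal (1 + 1) * K1 + ENNReal.ofReal (1 + 1⁻¹) *
    ENNReal.ofReal (K2 * (S.h / (S.M * l : ℕ))) ^ 2) fun i hi => ?_).trans_lt (by finiteness)
  have hi' := heldInputs_subset D (Data.Admissible.fast_period_pos hS hl) hi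
  refine (h2 l hl 1 one_pos D i hi').trans ?_
  rw [add_mul, mul_assoc, mul_assoc]
  gcongr
  exact h1 D i hi'

end Convergence

/-! ### Identification of the norms with gains -/

section Norms

variable {S : Data}

theorem vecEnergy_dlift {N : ℕ} (hN : 0 < N) (v : ℕ → ℝ) :
    vecEnergy (dlift N v) = dtEnergy v := by
  have : NeZero N := ⟨hN.ne'⟩
  rw [dtEnergy, ← (Nat.divModEquiv N).symm.tsum_eq, ENNReal.tsum_prod']
  simp only [tsum_fintype]
  rfl

theorem vecEnergy_eq_dtEnergy {N : ℕ} (hN : 0 < N) (w : ℕ → Fin N → ℝ) :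
    vecEnergy w = dtEnergy (idlift N w) := by
  rw [← vecEnergy_dlift hN, dlift_idlift]

theorem Data.normR_eq (S : Data) :
    S.normR = gain (inputs Set.univ) (S.outputEnergy 0) inputEnergy ^ (1 / 2 : ℝ) := by
  rw [Data.normR]
  congr 1
  refine le_antisymm (iSup_le fun w => iSup_le fun n => iSup_le fun hw => iSup_le fun hn =>
    iSup_le fun h0 => ?_) (iSup_le fun i => iSup_le fun hi => iSup_le fun h0 => ?_)
  · refine le_iSup_of_le (w, n) (le_iSup_of_le ⟨hw, hn, trivial⟩ (le_iSup_of_le h0 ?_))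
    simp only [Data.outputEnergy, inputEnergy, zero_mul, add_zero, le_refl]
  · refine le_iSup_of_le i.1 (le_iSup_of_le i.2 (le_iSup_of_le hi.1 (le_iSup_of_le hi.2.1
      (le_iSup_of_le h0 ?_))))
    simp only [Data.outputEnergy, inputEnergy, zero_mul, add_zero, le_refl]

theorem dtEnergy_zero : dtEnergy (fun _ => 0) = 0 := by simp [dtEnergy]

theorem Data.normT_eq (S : Data) :
    S.normT = gain (inputs {fun _ => 0}) (S.outputEnergy 1) inputEnergy ^ (1 / 2 : ℝ) := by
  rw [Data.normT]
  congr 1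
  refine le_antisymm (iSup_le fun w => iSup_le fun hw => iSup_le fun h0 => ?_)
    (iSup_le fun i => iSup_le fun hi => iSup_le fun h0 => ?_)
  · refine le_iSup_of_le (w, fun _ => 0) (le_iSup_of_le
      ⟨hw, by simp [dtEnergy_zero], rfl⟩ (le_iSup_of_le ?_ ?_))
    · simpa only [inputEnergy, dtEnergy_zero, add_zero] using h0
    · simp only [Data.outputEnergy, inputEnergy, one_mul, dtEnergy_zero, add_zero,
        Data.errT_eq_errR, le_refl]
  · obtain ⟨w, n⟩ := i
    obtain ⟨hw, -, rfl⟩ := hi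
    simp only [inputEnergy, dtEnergy_zero, add_zero] at h0
    refine le_iSup_of_le w (le_iSup_of_le hw (le_iSup_of_le h0 ?_))
    simp only [Data.outputEnergy, inputEnergy, one_mul, dtEnergy_zero, add_zero,
      Data.errT_eq_errR, le_refl]

theorem ofReal_inv_mul_ofReal {p c : ℝ} (hp : 0 < p) (hc : c = p⁻¹) :
    ENNReal.ofReal p * ENNReal.ofReal c = 1 := by
  rw [hc, ← ENNReal.ofReal_mul hp.le, mul_inv_cancel₀ hp.ne', ENNReal.ofReal_one]

theorem ofReal_mul_add_ofReal_mul {p : ℝ} (hp : 0 < p) {x y : ℝ≥0∞} {c : ℝ} (hc : c = p⁻¹) :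
    ENNReal.ofReal p * (x + ENNReal.ofReal c * y) = ENNReal.ofReal p * x + y := by
  rw [mul_add, ← mul_assoc, ofReal_inv_mul_ofReal hp hc, one_mul]

/-- Multiplying the quotient by `p = h / N` above and below cancels the weight on the noise and
turns sequence energies into energies of holds. Lifting is a bijection, so the lifted inputs
parametrize exactly the held ones. -/
theorem Data.inputScaledNorm_eq (hS : S.Admissible) {N : ℕ} (hN : 0 < N)
    {T : DTSystem (Fin N ⊕ Unit) (Fin N)} (hT : S.IsFSFHR N T) :
    inputScaledNorm (N / S.h) T = gain (heldInputs Set.univ (S.h / N))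
      (S.sampledEnergy 0 (S.h / N)) inputEnergy ^ (1 / 2 : ℝ) := by
  have hp : 0 < S.h / N := div_pos hS.h_pos (Nat.cast_pos.2 hN)
  have hc : (N : ℝ) / S.h = (S.h / N)⁻¹ := (inv_div _ _).symm
  have hp' : ENNReal.ofReal (S.h / N) ≠ 0 := (ENNReal.ofReal_pos.2 hp).ne'
  have hval : ∀ (w : ℕ → Fin N → ℝ) (n : ℕ → ℝ),
      vecEnergy (T.apply fun k => Sum.elim (w k) fun _ => n k) /
        (vecEnergy w + ENNReal.ofReal (N / S.h) * dtEnergy n) =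
      S.sampledEnergy 0 (S.h / N) (hold (S.h / N) (idlift N w), n) /
        inputEnergy (hold (S.h / N) (idlift N w), n) := fun w n => by
    rw [hT, vecEnergy_dlift hN, vecEnergy_eq_dtEnergy hN, Data.sampledEnergy, inputEnergy,
      zero_mul, add_zero, ctEnergy_hold hp, ctEnergy_hold hp, ← ofReal_mul_add_ofReal_mul hp hc,
      ENNReal.mul_div_mul_left _ _ hp' ENNReal.ofReal_ne_top]
  have hne : ∀ (w : ℕ → Fin N → ℝ) (n : ℕ → ℝ), vecEnergy w + dtEnergy n ≠ 0 ↔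
      inputEnergy (hold (S.h / N) (idlift N w), n) ≠ 0 := fun w n => by
    rw [inputEnergy, ctEnergy_hold hp, vecEnergy_eq_dtEnergy hN]
    simp [hp']
  rw [inputScaledNorm]
  congr 1
  refine le_antisymm (iSup_le fun w => iSup_le fun n => iSup_le fun hw => iSup_le fun hn =>
    iSup_le fun h0 => ?_) (iSup_le fun i => iSup_le fun hi => iSup_le fun h0 => ?_)
  · rw [vecEnergy_eq_dtEnergy hN] at hw
    exact le_iSup_of_le (hold (S.h / N) (idlift N w), n) (le_iSup_of_le
      ⟨⟨_, hw, rfl⟩, hn, trivial⟩ (le_iSup_of_le ((hne w n).1 h0) (hval w n).le))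
  · obtain ⟨_, n⟩ := i
    obtain ⟨⟨v, hv, rfl⟩, hn, -⟩ := hi
    rw [← idlift_dlift hN v] at h0 ⊢
    refine le_iSup_of_le (dlift N v) (le_iSup_of_le n (le_iSup_of_le ?_ (le_iSup_of_le hn
      (le_iSup_of_le ((hne _ n).2 h0) (hval _ n).ge))))
    rwa [vecEnergy_dlift hN]

/-- The same rescaling; now the factor `p` cancels the weight `N / h` on `z_d` in the numerator. -/
theorem Data.outputScaledNorm_eq (hS : S.Admissible) {N : ℕ} (hN : 0 < N)
    {T : DTSystem (Fin N) (Fin N ⊕ Unit)} (hT : S.IsFSFHT N T) :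
    outputScaledNorm (N / S.h) T = gain (heldInputs {fun _ => 0} (S.h / N))
      (S.sampledEnergy 1 (S.h / N)) inputEnergy ^ (1 / 2 : ℝ) := by
  have hp : 0 < S.h / N := div_pos hS.h_pos (Nat.cast_pos.2 hN)
  have hc : (N : ℝ) / S.h = (S.h / N)⁻¹ := (inv_div _ _).symm
  have hp' : ENNReal.ofReal (S.h / N) ≠ 0 := (ENNReal.ofReal_pos.2 hp).ne'
  have hval : ∀ w : ℕ → Fin N → ℝ,
      (vecEnergy (fun k i => T.apply w k (Sum.inl i)) +
        ENNReal.ofReal (N / S.h) * dtEnergy (fun k => T.apply w k (Sum.inr ()))) / vecEnergy w =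
      S.sampledEnergy 1 (S.h / N) (hold (S.h / N) (idlift N w), fun _ => 0) /
        inputEnergy (hold (S.h / N) (idlift N w), fun _ => 0) := fun w => by
    rw [hT]
    simp only [Sum.elim_inl, Sum.elim_inr]
    rw [vecEnergy_dlift hN, vecEnergy_eq_dtEnergy hN, Data.sampledEnergy, inputEnergy,
      dtEnergy_zero, add_zero, one_mul, ctEnergy_hold hp, ctEnergy_hold hp,
      ← ofReal_mul_add_ofReal_mul hp hc, ENNReal.mul_div_mul_left _ _ hp' ENNReal.ofReal_ne_top,
      Data.errT_eq_errR]
  have hne : ∀ w : ℕ → Fin N → ℝ, vecEnergy w ≠ 0 ↔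
      inputEnergy (hold (S.h / N) (idlift N w), fun _ => 0) ≠ 0 := fun w => by
    rw [inputEnergy, ctEnergy_hold hp, vecEnergy_eq_dtEnergy hN, dtEnergy_zero]
    simp [hp']
  rw [outputScaledNorm]
  congr 1
  refine le_antisymm (iSup_le fun w => iSup_le fun hw => iSup_le fun h0 => ?_)
    (iSup_le fun i => iSup_le fun hi => iSup_le fun h0 => ?_)
  · rw [vecEnergy_eq_dtEnergy hN] at hw
    exact le_iSup_of_le (hold (S.h / N) (idlift N w), fun _ => 0) (le_iSup_of_le
      ⟨⟨_, hw, rfl⟩, by simp [dtEnergy_zero], rfl⟩ (le_iSup_of_le ((hne w).1 h0) (hval w).le))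
  · obtain ⟨_, _⟩ := i
    obtain ⟨⟨v, hv, rfl⟩, -, rfl⟩ := hi
    rw [← idlift_dlift hN v] at h0 ⊢
    refine le_iSup_of_le (dlift N v) (le_iSup_of_le ?_ (le_iSup_of_le ((hne _).2 h0)
      (hval _).ge))
    rwa [vecEnergy_dlift hN]

end Norms

end

end CommSystem

theorem mainTheorem7 (S : CommSystem.Data) (hS : S.Admissible) (m : ℕ) (hL : S.L = m * S.h) :
    (S.normR < ∞ ∧
      ∃ T : (N : ℕ) → CommSystem.DTSystem (Fin N ⊕ Unit) (Fin N),
        (∀ l : ℕ, 0 < l →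
          S.IsFSFHR (S.M * l) (T (S.M * l)) ∧
          CommSystem.inputScaledNorm ((S.M * l : ℕ) / S.h) (T (S.M * l)) < ∞) ∧
        Tendsto (fun l : ℕ => CommSystem.inputScaledNorm ((S.M * l : ℕ) / S.h) (T (S.M * l)))
          atTop (𝓝 S.normR)) ∧
    (S.normT < ∞ ∧
      ∃ T : (N : ℕ) → CommSystem.DTSystem (Fin N) (Fin N ⊕ Unit),
        (∀ l : ℕ, 0 < l →
          S.IsFSFHT (S.M * l) (T (S.M * l)) ∧
          CommSystem.outputScaledNorm ((S.M * l : ℕ) / S.h) (T (S.M * l)) < ∞) ∧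
        Tendsto (fun l : ℕ => CommSystem.outputScaledNorm ((S.M * l : ℕ) / S.h) (T (S.M * l)))
          atTop (𝓝 S.normT)) := by
  classical
  have hsqrt : ∀ {x : ℝ≥0∞}, x < ∞ → x ^ (1 / 2 : ℝ) < ∞ := fun hx =>
    ENNReal.rpow_lt_top_of_nonneg (by norm_num) hx.ne
  refine ⟨⟨?_, ?_⟩, ?_, ?_⟩
  · rw [S.normR_eq]
    exact hsqrt (CommSystem.Data.gain_outputEnergy_lt_top hS ENNReal.zero_lt_top _)
  · let T : (N : ℕ) → CommSystem.DTSystem (Fin N ⊕ Unit) (Fin N) := fun N =>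
      if h : ∃ T, S.IsFSFHR N T then h.choose else ⟨0, 0, 0, 0, 0⟩
    have hT : ∀ l : ℕ, 0 < l → S.IsFSFHR (S.M * l) (T (S.M * l)) := fun l hl => by
      have h := CommSystem.Data.exists_isFSFHR hS hL hl
      simp only [T, dif_pos h]
      exact h.choose_spec
    have heq : ∀ l : ℕ, 0 < l → _ := fun l hl =>
      CommSystem.Data.inputScaledNorm_eq hS (Nat.mul_pos hS.M_pos hl) (hT l hl)
    refine ⟨T, fun l hl => ⟨hT l hl, ?_⟩, ?_⟩
    · rw [heq l hl]
      exact hsqrt (CommSystem.Data.gain_sampledEnergy_lt_top hS hL ENNReal.zero_lt_top _ hl)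
    · rw [S.normR_eq]
      refine Tendsto.congr' ((eventually_gt_atTop 0).mono fun l hl => (heq l hl).symm) ?_
      exact (ENNReal.continuous_rpow_const.tendsto _).comp
        (CommSystem.Data.tendsto_sampled_gain hS hL ENNReal.zero_lt_top _)
  · rw [S.normT_eq]
    exact hsqrt (CommSystem.Data.gain_outputEnergy_lt_top hS ENNReal.one_lt_top _)
  · let T : (N : ℕ) → CommSystem.DTSystem (Fin N) (Fin N ⊕ Unit) := fun N =>
      if h : ∃ T, S.IsFSFHT N T then h.choose else ⟨0, 0, 0, 0, 0⟩
    have hT : ∀ l : ℕ, 0 < l → S.IsFSFHT (S.M * l) (T (S.M * l)) := fun l hl => by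
      have h := CommSystem.Data.exists_isFSFHT hS hL hl
      simp only [T, dif_pos h]
      exact h.choose_spec
    have heq : ∀ l : ℕ, 0 < l → _ := fun l hl =>
      CommSystem.Data.outputScaledNorm_eq hS (Nat.mul_pos hS.M_pos hl) (hT l hl)
    refine ⟨T, fun l hl => ⟨hT l hl, ?_⟩, ?_⟩
    · rw [heq l hl]
      exact hsqrt (CommSystem.Data.gain_sampledEnergy_lt_top hS hL ENNReal.one_lt_top _ hl)
    · rw [S.normT_eq]
      refine Tendsto.congr' ((eventually_gt_atTop 0).mono fun l hl => (heq l hl).symm) ?_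
      exact (ENNReal.continuous_rpow_const.tendsto _).comp
        (CommSystem.Data.tendsto_sampled_gain hS hL ENNReal.one_lt_top _)
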